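/- A binary classical renewal process is a stationary process $X_0,X_1,X_2,\dots$ with values in $\{0,1\}$ obtained as follows: take a probability distribution $(p_k)_{k\ge0}$ on $\{0,1,2,\dots\}$ with $\sum_k kp_k<\infty$, take the stationary Markov chain $(M_n)_{n\ge0}$ on $\{0,1,2,\dots\}$ with transition probabilities $p_{0,k}=p_k$ and $p_{i,i-1}=1$ for $i\ge1$, and put $X_n=0$ if $M_n=0$ and $X_n=1$ otherwise. For such a process let $$\theta_n=E\bigl(\max\{k\ge0: X_i=1\text{ for all } n<i\le n+k\}\,\big|\,X_0,\dots,X_n\bigr)\in[0,\infty].$$ **Theorem 4.** Let $(\lambda_n)$ be a sequence of stopping times (with respect to $X_0,X_1,\dots$, defined on sequences of zeros and ones independently of the process distribution) and let $(h_n)$ be a sequence of real-valued estimators $h_n(X_0,\dots,X_{\lambda_n})$. Suppose that, for every binary classical renewal process, almost surely the sequence $(\lambda_n)$ is strictly increasing and $\lim_{n\to\infty}\lambda_n/n=1$. Then there exists a binary classical renewal process such that $$P\Bigl(\limsup_{n\to\infty}\bigl|h_n(X_0,\dots,X_{\lambda_n})-\theta_{\lambda_n}\bigr|>0\Bigr)>0.$$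 -/

import Mathlib

open MeasureTheory ProbabilityTheory Filter Topology
open scoped ENNReal

noncomputable section

namespace BinaryRenewal

/-- Sample paths `X_0, X_1, …` of a `{0,1}`-valued process. -/
abbrev Path : Type := ℕ → Fin 2

/-- Transition probabilities of the chain on `{0, 1, 2, …}` that jumps from `0` to `j` with
probability `p j` and steps deterministically from `i + 1` to `i`. -/
def step (p : PMF ℕ) : ℕ → ℕ → ℝ≥0∞
  | 0, j => p j
  | i + 1, j => if j = i then 1 else 0

/-- `Q` is the law of a stationary Markov chain `M_0, M_1, …` on `{0, 1, 2, …}` with the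
transition probabilities `step p`. -/
structure IsStationaryChain (p : PMF ℕ) (Q : Measure (ℕ → ℕ)) : Prop where
  isProbabilityMeasure : IsProbabilityMeasure Q
  markov : ∀ (n : ℕ) (s : ℕ → ℕ),
    Q {m | ∀ i ≤ n, m i = s i}
      = Q {m | m 0 = s 0} * ∏ i ∈ Finset.range n, step p (s i) (s (i + 1))
  stationary : MeasurePreserving (fun (m : ℕ → ℕ) (i : ℕ) => m (i + 1)) Q Q

/-- Collapse all states `i ≥ 1` to `1`. -/
def collapse (m : ℕ → ℕ) : Path := fun n => if m n = 0 then 0 else 1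

/-- `P` is the law of a (stationary, one-sided) binary classical renewal process: for some
distribution `p` with finite mean of the lengths of the runs of ones, it is the law of the
collapsed stationary chain. -/
def IsRenewalLaw (P : Measure Path) : Prop :=
  ∃ p : PMF ℕ, ∑' k : ℕ, (k : ℝ≥0∞) * p k < ∞ ∧
    ∃ Q : Measure (ℕ → ℕ), IsStationaryChain p Q ∧ P = Q.map collapse

/-- The residual waiting time at time `n`: the largest `k ≥ 0` such that `X_i = 1` for all
`n < i ≤ n + k` (infinite if no further zero occurs). -/
def residual (n : ℕ) (x : Path) : ℕ∞ :=
  ⨆ (k : ℕ) (_ : ∀ i, n < i → i ≤ n + k → x i = 1), (k : ℕ∞)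

/-- `θ_n`, the conditional expectation under `P` of the residual waiting time at time `n`
given `X_0, …, X_n`, as a function of the path; it takes values in `[0, ∞]`. Since
`(X_0, …, X_n)` has finitely many values, this is the mean under the elementary conditional
probability given the observed values. -/
def theta (P : Measure Path) (n : ℕ) (x : Path) : ℝ≥0∞ :=
  ∫⁻ y, (residual n y : ℝ≥0∞) ∂(P[|{y : Path | ∀ i ≤ n, y i = x i}])

/-- The observed string `(X_0, …, X_k)`. -/
def observed (k : ℕ) (x : Path) : Fin (k + 1) → Fin 2 := fun i => x i

/-- The filtration on path space generated by the coordinates, `ℱ_k = σ(X_0, …, X_k)`. -/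
abbrev pathFiltration : Filtration ℕ (inferInstance : MeasurableSpace Path) :=
  Filtration.piLE (X := fun _ : ℕ => Fin 2)

end BinaryRenewal

end

/-! At a fixed age the mean residual life is very sensitive to a small mass far out in the run
length law, while a finite stretch of the path hardly sees such a mass. Stopping times of density
one cannot avoid the ages where this matters.

Suppose `a` is the longest possible run. At age `a`, that is after `a` ones since the last zero, the
mean residual life is 0. Age `a` recurs with positive frequency, so by some time `T` a stopping time
of index at least `j` meets it with substantial probability (`exists_hits`). Either the estimate
there is at least 1/2 with substantial probability, and is wrong for this law, or it is below 1/2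
with substantial probability. In the second case a small mass far out raises the mean residual life
at age `a` above 3/4 (`exists_raised`), while path probabilities up to `T` drop by a factor of at
most about 2 (`chainLaw_comparison`); so the low estimate still occurs and is now wrong. Either
error survives small changes of the law.

The laws are parametrized by `ℓ¹`. In `weight` the factor `1 / (k + 1)` makes means finite and
continuous in the parameter, and the unit mass at `0` keeps the total positive. For each `j`, a
dense open set of parameters gives an error of at least 1/4 at some index at least `j` with
probability at least `zeroProb u / 8` (`exists_eventually_bad`). By Baire's theorem one parameter
serves all `j` (`exists_forall_bad`). Since the bound does not depend on `j`, infinitely many errors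
occur with positive probability. -/

noncomputable section

namespace BinaryRenewal

section

/-! ### The chain driven by independent inputs -/

/-- One step of the chain from state `i`, when `r` is the length of the next run. -/
def next (i r : ℕ) : ℕ := if i = 0 then r else i - 1

/-- The chain with initial state `ω 0` in which `ω (n + 1)` is the run length drawn at time `n`. -/
def chain (ω : ℕ → ℕ) : ℕ → ℕ
  | 0 => ω 0
  | n + 1 => next (chain ω n) (ω (n + 1))

/-- The distribution of the input at each time. -/
def inputPMF (μ p : PMF ℕ) : ℕ → PMF ℕ
  | 0 => μ
  | _ + 1 => p

/-- The law of independent inputs. -/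
def inputs (μ p : PMF ℕ) : Measure (ℕ → ℕ) :=
  Measure.infinitePi fun i => (inputPMF μ p i).toMeasure

instance (μ p : PMF ℕ) : IsProbabilityMeasure (inputs μ p) := by
  unfold inputs; infer_instance

lemma chain_congr {ω ω' : ℕ → ℕ} {n : ℕ} (h : ∀ i ≤ n, ω i = ω' i) : chain ω n = chain ω' n := by
  induction n with
  | zero => exact h 0 le_rfl
  | succ n ih => rw [chain, chain, ih fun i hi => h i (by omega), h _ le_rfl]

lemma measurable_chain : Measurable chain := by
  refine measurable_pi_lambda _ fun n => ?_
  induction n with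
  | zero => exact measurable_pi_apply 0
  | succ n ih =>
    have h : Measurable fun q : ℕ × ℕ => next q.1 q.2 := Measurable.of_discrete
    exact h.comp (ih.prodMk (measurable_pi_apply (n + 1)))

variable (μ p : PMF ℕ)

lemma map_eval_inputs (i : ℕ) :
    (inputs μ p).map (fun ω => ω i) = (inputPMF μ p i).toMeasure :=
  Measure.infinitePi_map_eval _ i

lemma iIndepFun_inputs : iIndepFun (fun (i : ℕ) (ω : ℕ → ℕ) => ω i) (inputs μ p) :=
  iIndepFun_infinitePi (X := fun _ ω => ω) (by fun_prop)

/-- Such an `f` factors through finitely many coordinates, hence through a countable discrete space.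
-/
lemma measurable_of_past {α β : Type*} [MeasurableSpace α] [Countable α]
    [MeasurableSingletonClass α] [Inhabited α] [MeasurableSpace β] {n : ℕ} {f : (ℕ → α) → β}
    (hf : ∀ ω ω' : ℕ → α, (∀ i ≤ n, ω i = ω' i) → f ω = f ω') : Measurable f := by
  let g : ((i : Finset.range (n + 1)) → α) → β := fun w =>
    f fun i => if h : i ∈ Finset.range (n + 1) then w ⟨i, h⟩ else default
  have hg : f = g ∘ fun ω i => ω i := by
    funext ω
    refine hf _ _ fun i hi => ?_
    rw [dif_pos (Finset.mem_range.2 (by omega))]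
  rw [hg]
  exact (Measurable.of_discrete (f := g)).comp (measurable_pi_lambda _ fun i => measurable_pi_apply _)

lemma measurableSet_of_past {α : Type*} [MeasurableSpace α] [Countable α]
    [MeasurableSingletonClass α] [Inhabited α] {n : ℕ} {S : Set (ℕ → α)}
    (hS : ∀ ω ω' : ℕ → α, (∀ i ≤ n, ω i = ω' i) → (ω ∈ S ↔ ω' ∈ S)) : MeasurableSet S := by
  have h := measurable_of_past (f := fun ω => ω ∈ S) fun ω ω' hω => propext (hS ω ω' hω)
  simpa using measurableSet_setOfPred.2 h

/-- What is determined by the inputs up to time `n` is independent of the next input. -/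
lemma indepFun_of_past {β : Type*} [MeasurableSpace β] {n : ℕ} {f : (ℕ → ℕ) → β}
    (hf : ∀ ω ω' : ℕ → ℕ, (∀ i ≤ n, ω i = ω' i) → f ω = f ω') :
    IndepFun f (fun ω => ω (n + 1)) (inputs μ p) := by
  let g : ((i : Finset.range (n + 1)) → ℕ) → β := fun w =>
    f fun i => if h : i ∈ Finset.range (n + 1) then w ⟨i, h⟩ else 0
  have hg : f = g ∘ fun ω i => ω i := by
    funext ω
    refine hf _ _ fun i hi => ?_
    rw [dif_pos (Finset.mem_range.2 (by omega))]
  have h := (iIndepFun_inputs μ p).indepFun_finset (Finset.range (n + 1)) {n + 1} (by simp)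
    fun i => measurable_pi_apply i
  rw [hg]
  exact h.comp (Measurable.of_discrete (f := g))
    (ψ := fun w => w ⟨n + 1, by simp⟩) Measurable.of_discrete

/-- Conditional law of the next input. -/
lemma inputs_inter_next {n : ℕ} {A : Set (ℕ → ℕ)}
    (hA : ∀ ω ω' : ℕ → ℕ, (∀ i ≤ n, ω i = ω' i) → (ω ∈ A ↔ ω' ∈ A)) (B : Set ℕ) :
    inputs μ p (A ∩ {ω | ω (n + 1) ∈ B}) = inputs μ p A * p.toMeasure B := by
  have h := indepFun_of_past μ p (f := fun ω => ω ∈ A) fun ω ω' hω => propext (hA ω ω' hω)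
  have h2 := h.measure_inter_preimage_eq_mul {True} B .of_discrete .of_discrete
  have h3 : (fun ω => ω ∈ A) ⁻¹' {True} = A := by ext; simp
  rw [h3] at h2
  refine h2.trans ?_
  congr 1
  rw [← Measure.map_apply (measurable_pi_apply (n + 1)) .of_discrete]
  exact congrArg (fun ν => ν B) (map_eval_inputs μ p (n + 1))

/-- The chain has the Markov property. -/
lemma chain_markov (n : ℕ) (s : ℕ → ℕ) :
    inputs μ p {ω | ∀ i ≤ n, chain ω i = s i}
      = μ (s 0) * ∏ i ∈ Finset.range n, step p (s i) (s (i + 1)) := by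
  induction n with
  | zero =>
    have h : {ω : ℕ → ℕ | ∀ i ≤ 0, chain ω i = s i} = (fun ω => ω 0) ⁻¹' {s 0} := by
      ext ω; simp [chain]
    rw [h, ← Measure.map_apply (measurable_pi_apply 0) .of_discrete, map_eval_inputs]
    simp [inputPMF, PMF.toMeasure_apply_singleton]
  | succ n ih =>
    rw [Finset.prod_range_succ, ← mul_assoc, ← ih]
    have hA : ∀ ω ω' : ℕ → ℕ, (∀ i ≤ n, ω i = ω' i) →
        (ω ∈ {ω | ∀ i ≤ n, chain ω i = s i} ↔ ω' ∈ {ω | ∀ i ≤ n, chain ω i = s i}) := by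
      intro ω ω' h
      refine forall₂_congr fun i hi => ?_
      rw [chain_congr fun j hj => h j (by omega)]
    -- The transition probability is the `p`-mass of the inputs that move `s n` to `s (n + 1)`; from
    -- a positive state this set is everything or empty.
    have h := inputs_inter_next μ p hA {r | next (s n) r = s (n + 1)}
    convert h using 1
    · congr 1
      ext ω
      constructor
      · intro h
        refine ⟨fun i hi => h i (by omega), ?_⟩
        have := h (n + 1) le_rfl
        rw [chain, h n (by omega)] at this
        exact this
      · rintro ⟨h1, h2⟩ i hi
        rcases Nat.lt_or_ge n i with h3 | h3
        · obtain rfl : i = n + 1 := by omega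
          rw [chain, h1 n le_rfl]
          exact h2
        · exact h1 i h3
    · congr 1
      rcases hs : s n with _ | k
      · simp only [step, next, if_true, Set.ofPred_eq_eq_singleton]
        rw [PMF.toMeasure_apply_singleton _ _ .of_discrete]
      · simp only [step, next, Nat.succ_ne_zero, if_false, Nat.add_sub_cancel]
        by_cases h : k = s (n + 1) <;> simp [h, Ne.symm]

/-! ### The stationary distribution -/

/-- The tail `p {k | a ≤ k}`. -/
def tail (p : PMF ℕ) (a : ℕ) : ℝ≥0∞ := ∑' k, if a ≤ k then p k else 0

lemma tail_zero : tail p 0 = 1 := by simp [tail, p.tsum_coe]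

lemma tail_succ (a : ℕ) : tail p a = p a + tail p (a + 1) := by
  have h : ∀ k, (if a ≤ k then p k else 0) = (if k = a then p a else 0)
      + if a + 1 ≤ k then p k else 0 := by
    intro k
    rcases lt_trichotomy k a with h | rfl | h
    · simp [h.ne, not_le.2 h, show ¬ a + 1 ≤ k by omega]
    · simp
    · simp [h.ne', h.le, Nat.succ_le_of_lt h]
  rw [tail, tail, tsum_congr h, ENNReal.tsum_add, tsum_ite_eq]

/-- In the double sum `p k` is counted `k + 1` times. A finite mean is thus what allows the tails to
be normalized to `stat`. -/
lemma tsum_tail : ∑' a, tail p a = 1 + ∑' k : ℕ, (k : ℝ≥0∞) * p k := by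
  unfold tail
  rw [ENNReal.tsum_comm]
  have h : ∀ k : ℕ, (∑' a, if a ≤ k then p k else 0) = p k + (k : ℝ≥0∞) * p k := by
    intro k
    rw [tsum_eq_sum (s := Finset.range (k + 1))
      fun b hb => if_neg fun h => hb (Finset.mem_range.2 (by omega)),
      Finset.sum_congr rfl fun a ha => if_pos (Nat.lt_succ_iff.1 (Finset.mem_range.1 ha))]
    simp; ring
  rw [tsum_congr h, ENNReal.tsum_add, p.tsum_coe]

variable {p} (hp : ∑' k : ℕ, (k : ℝ≥0∞) * p k < ∞)

/-- The stationary distribution of the chain. -/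
def stat : PMF ℕ :=
  PMF.normalize (tail p) (by rw [tsum_tail]; simp) (by
    rw [tsum_tail]; exact ENNReal.add_ne_top.2 ⟨by simp, hp.ne⟩)

/-- This is the balance equation: `k` is entered from `0` by drawing `k`, and from `k + 1` by
counting down. -/
lemma stat_eq (k : ℕ) : stat hp k = stat hp 0 * p k + stat hp (k + 1) := by
  simp only [stat, PMF.normalize_apply, tail_zero, one_mul]
  rw [tail_succ p k, add_mul, mul_comm (p k)]

lemma stat_zero_pos : 0 < stat hp 0 := by
  simp only [stat, PMF.normalize_apply, tail_zero, one_mul, ENNReal.inv_pos]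
  rw [tsum_tail]; exact ENNReal.add_ne_top.2 ⟨by simp, hp.ne⟩

/-- Advance the inputs by one time step of the chain. -/
def advance (ω : ℕ → ℕ) : ℕ → ℕ
  | 0 => next (ω 0) (ω 1)
  | i + 1 => ω (i + 2)

lemma chain_advance (ω : ℕ → ℕ) (n : ℕ) : chain (advance ω) n = chain ω (n + 1) := by
  induction n with
  | zero => rfl
  | succ n ih => rw [chain, ih, chain]; rfl

lemma measurable_next : Measurable fun ω : ℕ → ℕ => next (ω 0) (ω 1) := by
  have h : Measurable fun q : ℕ × ℕ => next q.1 q.2 := Measurable.of_discrete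
  exact h.comp (f := fun ω : ℕ → ℕ => (ω 0, ω 1)) (by fun_prop)

lemma measurable_advance : Measurable advance := by
  refine measurable_pi_lambda _ fun n => ?_
  cases n with
  | zero => exact measurable_next
  | succ n => exact measurable_pi_apply (n + 2)

lemma inputs_next_mem (t : Set ℕ) :
    inputs (stat hp) p {ω | next (ω 0) (ω 1) ∈ t} = (stat hp).toMeasure t := by
  have hm := measurable_next
  suffices h : (inputs (stat hp) p).map (fun ω => next (ω 0) (ω 1)) = (stat hp).toMeasure by
    rw [← h, Measure.map_apply hm .of_discrete]; rfl
  refine Measure.ext_of_singleton fun k => ?_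
  rw [Measure.map_apply hm .of_discrete, PMF.toMeasure_apply_singleton _ _ .of_discrete, stat_eq hp k]
  have h0 : ∀ (i : ℕ) (B : Set ℕ), inputs (stat hp) p ({ω | ω 0 = i} ∩ {ω | ω 1 ∈ B})
      = stat hp i * p.toMeasure B := by
    intro i B
    rw [inputs_inter_next (n := 0)]
    · congr 1
      have := chain_markov (stat hp) p 0 fun _ => i
      simpa [chain] using this
    · intro ω ω' h
      simp [h 0 le_rfl]
  have h1 : (fun ω : ℕ → ℕ => next (ω 0) (ω 1)) ⁻¹' {k}
      = ({ω | ω 0 = 0} ∩ {ω | ω 1 ∈ ({k} : Set ℕ)})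
        ∪ ({ω | ω 0 = k + 1} ∩ {ω | ω 1 ∈ Set.univ}) := by
    ext ω
    simp only [next, Set.mem_preimage, Set.mem_singleton_iff, Set.mem_union, Set.mem_inter_iff,
      Set.mem_ofPred_eq, Set.mem_univ, and_true]
    split_ifs with h <;> omega
  rw [h1, measure_union, h0, h0, PMF.toMeasure_apply_singleton _ _ .of_discrete]
  · simp
  · refine Set.disjoint_left.2 ?_
    rintro ω ⟨h, -⟩ ⟨h', -⟩
    simp only [Set.mem_ofPred_eq] at h h'
    omega
  · exact (measurable_pi_apply 0 (.of_discrete) : MeasurableSet ((fun ω : ℕ → ℕ => ω 0) ⁻¹' {k + 1})).inter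
      (measurable_pi_apply 1 .of_discrete : MeasurableSet ((fun ω : ℕ → ℕ => ω 1) ⁻¹' Set.univ))

/-- The new initial state uses only inputs `0` and `1` and again has law `stat`; the remaining
inputs are independent of it and are merely shifted. Stationarity of the chain follows through
`chain_advance`. -/
lemma map_advance : (inputs (stat hp) p).map advance = inputs (stat hp) p := by
  refine Measure.eq_infinitePi _ fun s t _ => ?_
  rw [Measure.map_apply measurable_advance
    (MeasurableSet.pi s.countable_toSet fun _ _ => .of_discrete)]
  have hins : ∀ s : Finset ℕ, 0 ∉ s → ∀ A : Set ℕ,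
      inputs (stat hp) p ({ω | next (ω 0) (ω 1) ∈ A} ∩ {ω | ∀ i ∈ s, ω (i + 1) ∈ t i})
        = (stat hp).toMeasure A * ∏ i ∈ s, (inputPMF (stat hp) p i).toMeasure (t i) := by
    intro s hs A
    have hS : Disjoint {0, 1} (s.image (· + 1)) := by
      rw [Finset.disjoint_left]
      intro i hi hi'
      obtain ⟨j, hj, rfl⟩ := Finset.mem_image.1 hi'
      have : j ≠ 0 := fun h => hs (h ▸ hj)
      simp only [Finset.mem_insert, Finset.mem_singleton] at hi
      omega
    have h := (iIndepFun_inputs (stat hp) p).indepFun_finset {0, 1} (s.image (· + 1)) hS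
      fun i => measurable_pi_apply i
    have h2 := h.measure_inter_preimage_eq_mul
      {w | next (w ⟨0, by simp⟩) (w ⟨1, by simp⟩) ∈ A}
      {w | ∀ (i : ℕ) (hi : i ∈ s), w ⟨i + 1, Finset.mem_image_of_mem _ hi⟩ ∈ t i}
      (Set.to_countable _).measurableSet (Set.to_countable _).measurableSet
    refine h2.trans ?_
    have h3 := inputs_next_mem hp A
    congr 1
    have h4 : (fun (a : ℕ → ℕ) (i : (s.image (· + 1) : Finset ℕ)) => a i) ⁻¹'
        {w | ∀ (i : ℕ) (hi : i ∈ s), w ⟨i + 1, Finset.mem_image_of_mem _ hi⟩ ∈ t i}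
        = Set.pi (s.image (· + 1) : Finset ℕ) fun i => t (i - 1) := by
      ext ω
      simp [Set.mem_pi]
    rw [h4, inputs, Measure.infinitePi_pi _ fun _ _ => .of_discrete, Finset.prod_image (by simp)]
    refine Finset.prod_congr rfl fun i hi => ?_
    obtain ⟨j, rfl⟩ : ∃ j, i = j + 1 := Nat.exists_eq_succ_of_ne_zero fun h => hs (h ▸ hi)
    rfl
  by_cases hs : 0 ∈ s
  · have h := hins (s.erase 0) (by simp) (t 0)
    rw [← Finset.mul_prod_erase _ _ hs]
    refine Eq.trans ?_ h
    congr 1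
    ext ω
    simp only [Set.mem_preimage, Set.mem_pi, Finset.mem_coe, Finset.mem_erase, Set.mem_inter_iff,
      Set.mem_ofPred_eq]
    constructor
    · intro h
      refine ⟨h 0 hs, fun i hi => ?_⟩
      obtain ⟨j, rfl⟩ := Nat.exists_eq_succ_of_ne_zero hi.1
      exact h _ hi.2
    · rintro ⟨h1, h2⟩ i hi
      cases i with
      | zero => exact h1
      | succ j => exact h2 (j + 1) ⟨by simp, hi⟩
  · have h := hins s hs Set.univ
    simp only [measure_univ, one_mul, Set.mem_univ, Set.ofPred_true, Set.univ_inter] at h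
    refine Eq.trans ?_ h
    congr 1
    ext ω
    simp only [Set.mem_preimage, Set.mem_pi, Finset.mem_coe, Set.mem_ofPred_eq]
    refine forall₂_congr fun i hi => ?_
    obtain ⟨j, rfl⟩ := Nat.exists_eq_succ_of_ne_zero (n := i) fun h => hs (h ▸ hi)
    rfl

/-- The law of the stationary chain. -/
def chainLaw : Measure (ℕ → ℕ) := (inputs (stat hp) p).map chain

instance : IsProbabilityMeasure (chainLaw hp) :=
  Measure.isProbabilityMeasure_map measurable_chain.aemeasurable

lemma measurableSet_cylinder (n : ℕ) (s : ℕ → ℕ) :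
    MeasurableSet {m : ℕ → ℕ | ∀ i ≤ n, m i = s i} := by
  have h : {m : ℕ → ℕ | ∀ i ≤ n, m i = s i} = Set.pi (Set.Iic n) fun i => {s i} := by
    ext; simp [Set.mem_pi]
  rw [h]
  exact MeasurableSet.pi (Set.to_countable _) fun _ _ => .of_discrete

lemma chainLaw_cylinder (n : ℕ) (s : ℕ → ℕ) :
    chainLaw hp {m | ∀ i ≤ n, m i = s i}
      = stat hp (s 0) * ∏ i ∈ Finset.range n, step p (s i) (s (i + 1)) := by
  rw [chainLaw, Measure.map_apply measurable_chain (measurableSet_cylinder n s)]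
  exact chain_markov _ _ n s

lemma isStationaryChain_chainLaw : IsStationaryChain p (chainLaw hp) where
  isProbabilityMeasure := inferInstance
  markov n s := by
    have h := chainLaw_cylinder hp 0 s
    simp only [Nat.le_zero, forall_eq, Finset.range_zero, Finset.prod_empty, mul_one] at h
    rw [chainLaw_cylinder, h]
  stationary := by
    have hm : Measurable fun (m : ℕ → ℕ) (i : ℕ) => m (i + 1) :=
      measurable_pi_lambda _ fun i => measurable_pi_apply (i + 1)
    refine ⟨hm, ?_⟩
    rw [chainLaw, Measure.map_map hm measurable_chain]
    conv_rhs => rw [← map_advance hp, Measure.map_map measurable_chain measurable_advance]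
    congr 1
    funext ω n
    exact (chain_advance ω n).symm

lemma measurable_collapse : Measurable collapse := by
  refine measurable_pi_lambda _ fun n => ?_
  have h : Measurable fun k : ℕ => if k = 0 then (0 : Fin 2) else 1 := Measurable.of_discrete
  exact h.comp (measurable_pi_apply n)

/-- The law of the stationary binary renewal process. -/
def renewalLaw : Measure Path := (chainLaw hp).map collapse

instance : IsProbabilityMeasure (renewalLaw hp) :=
  Measure.isProbabilityMeasure_map measurable_collapse.aemeasurable

lemma isRenewalLaw_renewalLaw : IsRenewalLaw (renewalLaw hp) :=
  ⟨p, hp, chainLaw hp, isStationaryChain_chainLaw hp, rfl⟩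

end

section

/-! ### The conditional mean of the residual waiting time -/

lemma chain_countdown {ω : ℕ → ℕ} {b : ℕ} (hb : chain ω b = 0) {j : ℕ} (hj : j ≤ ω (b + 1)) :
    chain ω (b + 1 + j) = ω (b + 1) - j := by
  induction j with
  | zero => rw [add_zero, chain, hb]; rfl
  | succ j ih =>
    rw [← add_assoc, chain, ih (by omega), next, if_neg (by omega)]
    omega

lemma collapse_eq_zero {m : ℕ → ℕ} {n : ℕ} : collapse m n = 0 ↔ m n = 0 := by
  unfold collapse; split_ifs with h <;> simp [h]

lemma collapse_eq_one {m : ℕ → ℕ} {n : ℕ} : collapse m n = 1 ↔ m n ≠ 0 := by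
  unfold collapse; split_ifs with h <;> simp [h]

/-- After a zero at time `b`, the next `a` symbols are ones iff the run length drawn at time `b`
is at least `a`. -/
lemma run_iff {ω : ℕ → ℕ} {b : ℕ} (hb : chain ω b = 0) (a : ℕ) :
    (∀ i, b < i → i ≤ b + a → collapse (chain ω) i = 1) ↔ a ≤ ω (b + 1) := by
  constructor
  · intro h
    by_contra! hlt
    have h1 := h (b + 1 + ω (b + 1)) (by omega) (by omega)
    rw [collapse_eq_one, chain_countdown hb le_rfl] at h1
    omega
  · intro h i hi hi'
    obtain ⟨j, rfl⟩ := Nat.exists_eq_add_of_le (Nat.succ_le_of_lt hi)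
    rw [Nat.succ_eq_add_one, collapse_eq_one, chain_countdown hb (by omega)]
    omega

lemma residual_eq {ω : ℕ → ℕ} {b a : ℕ} (hb : chain ω b = 0) (ha : a ≤ ω (b + 1)) :
    residual (b + a) (collapse (chain ω)) = ((ω (b + 1) - a : ℕ) : ℕ∞) := by
  have key : ∀ k, (∀ i, b + a < i → i ≤ b + a + k → collapse (chain ω) i = 1)
      ↔ k ≤ ω (b + 1) - a := by
    intro k
    have h := run_iff hb (a + k)
    constructor
    · intro hk
      have := h.1 fun i hi hi' => by
        rcases Nat.lt_or_ge (b + a) i with h1 | h1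
        · exact hk i h1 (by omega)
        · exact (run_iff hb a).2 ha i hi h1
      omega
    · intro hk i hi hi'
      exact h.2 (by omega) i (by omega) (by omega)
  unfold residual
  refine le_antisymm (iSup₂_le fun k hk => ?_) ?_
  · exact_mod_cast (key k).1 hk
  · exact le_iSup₂_of_le (ω (b + 1) - a) ((key _).2 le_rfl) le_rfl

lemma measurable_residual (n : ℕ) : Measurable fun x => (residual n x : ℝ≥0∞) := by
  have h : ∀ x, (residual n x : ℝ≥0∞)
      = ⨆ k : ℕ, {x : Path | ∀ i, n < i → i ≤ n + k → x i = 1}.indicator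
          (fun _ => (k : ℝ≥0∞)) x := by
    intro x
    rw [residual, ENat.toENNReal_iSup]
    refine iSup_congr fun k => ?_
    by_cases hk : ∀ i, n < i → i ≤ n + k → x i = 1
    · rw [Set.indicator_of_mem (by exact hk), iSup_pos hk]; rfl
    · rw [Set.indicator_of_notMem (by exact hk), iSup_neg hk]; simp
  simp_rw [h]
  refine Measurable.iSup fun k => measurable_const.indicator ?_
  have h2 : {x : Path | ∀ i, n < i → i ≤ n + k → x i = 1}
      = Set.pi (Set.Ioc n (n + k)) fun _ => {1} := by
    ext x; simp [Set.mem_pi]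
  rw [h2]
  exact MeasurableSet.pi (Set.to_countable _) fun _ _ => .of_discrete

lemma measurableSet_pathCylinder (n : ℕ) (x : Path) :
    MeasurableSet {y : Path | ∀ i ≤ n, y i = x i} := by
  have h : {y : Path | ∀ i ≤ n, y i = x i} = Set.pi (Set.Iic n) fun i => {x i} := by
    ext; simp [Set.mem_pi]
  rw [h]
  exact MeasurableSet.pi (Set.to_countable _) fun _ _ => .of_discrete

lemma toMeasure_Ici (p : PMF ℕ) (a : ℕ) : p.toMeasure {k | a ≤ k} = tail p a := by
  rw [PMF.toMeasure_apply_eq_tsum, tail]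
  refine tsum_congr fun k => ?_
  simp [Set.indicator_apply]

variable {p : PMF ℕ} (hp : ∑' k : ℕ, (k : ℝ≥0∞) * p k < ∞)

lemma renewalLaw_apply {s : Set Path} (hs : MeasurableSet s) :
    renewalLaw hp s = inputs (stat hp) p {ω | collapse (chain ω) ∈ s} := by
  rw [renewalLaw, Measure.map_apply measurable_collapse hs, chainLaw,
    Measure.map_apply measurable_chain (measurable_collapse hs)]
  rfl

/-- The mean residual life at age `a`. -/
lemma theta_renewalLaw {x : Path} {b a : ℕ} (hxb : x b = 0)
    (hx : ∀ i, b < i → i ≤ b + a → x i = 1)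
    (hpos : renewalLaw hp {y | ∀ i ≤ b + a, y i = x i} ≠ 0) :
    theta (renewalLaw hp) (b + a) x = (∑' k, ((k - a : ℕ) : ℝ≥0∞) * p k) / tail p a := by
  set A : Set (ℕ → ℕ) := {ω | ∀ i ≤ b, collapse (chain ω) i = x i} with hAdef
  have hA : ∀ ω ω' : ℕ → ℕ, (∀ i ≤ b, ω i = ω' i) → (ω ∈ A ↔ ω' ∈ A) := by
    intro ω ω' h
    refine forall₂_congr fun i hi => ?_
    rw [collapse, collapse, chain_congr fun j hj => h j (by omega)]
  have hA0 : ∀ ω ∈ A, chain ω b = 0 := fun ω hω => by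
    have := hω b le_rfl
    rwa [hxb, collapse_eq_zero] at this
  -- The conditioning event splits into an event `A` of the past up to `b` and the condition that
  -- the next input is at least `a`. By independence the probability of `A` cancels in the end.
  have hpre : {ω | collapse (chain ω) ∈ {y : Path | ∀ i ≤ b + a, y i = x i}}
      = A ∩ {ω | ω (b + 1) ∈ {k | a ≤ k}} := by
    ext ω
    constructor
    · intro h
      have hω : ω ∈ A := fun i hi => h i (by omega)
      refine ⟨hω, (run_iff (hA0 ω hω) a).1 fun i hi hi' => ?_⟩
      rw [h i hi', hx i hi hi']
    · rintro ⟨hω, h⟩ i hi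
      rcases Nat.lt_or_ge b i with h1 | h1
      · rw [hx i h1 hi]
        exact (run_iff (hA0 ω hω) a).2 h i h1 hi
      · exact hω i h1
  have hC : renewalLaw hp {y | ∀ i ≤ b + a, y i = x i} = inputs (stat hp) p A * tail p a := by
    rw [renewalLaw_apply hp (measurableSet_pathCylinder _ _), hpre,
      inputs_inter_next _ _ hA, toMeasure_Ici]
  have hAm : MeasurableSet A := measurableSet_of_past hA
  have hint : ∫⁻ y in {y | ∀ i ≤ b + a, y i = x i}, (residual (b + a) y : ℝ≥0∞) ∂(renewalLaw hp)
      = inputs (stat hp) p A * ∑' k, ((k - a : ℕ) : ℝ≥0∞) * p k := by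
    have hm := (measurableSet_pathCylinder (b + a) x)
    rw [renewalLaw, chainLaw, Measure.map_map measurable_collapse measurable_chain,
      setLIntegral_map hm (measurable_residual _) (measurable_collapse.comp measurable_chain)]
    have h1 : (collapse ∘ chain) ⁻¹' {y | ∀ i ≤ b + a, y i = x i}
      = A ∩ {ω | ω (b + 1) ∈ {k | a ≤ k}} := hpre
    rw [h1]
    have hE : MeasurableSet (A ∩ {ω : ℕ → ℕ | ω (b + 1) ∈ {k | a ≤ k}}) := by
      rw [← h1]; exact (measurable_collapse.comp measurable_chain) hm
    -- Truncated subtraction vanishes for inputs below `a`, so the second condition needs no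
    -- indicator.
    have h2 : ∀ ω, (A ∩ {ω : ℕ → ℕ | ω (b + 1) ∈ {k | a ≤ k}}).indicator
        (fun ω => (residual (b + a) ((collapse ∘ chain) ω) : ℝ≥0∞)) ω
        = A.indicator 1 ω * ((ω (b + 1) - a : ℕ) : ℝ≥0∞) := by
      intro ω
      by_cases hω : ω ∈ A
      · by_cases h3 : a ≤ ω (b + 1)
        · rw [Set.indicator_of_mem (by exact ⟨hω, h3⟩), Set.indicator_of_mem hω, Function.comp,
            residual_eq (hA0 ω hω) h3]
          simp
        · rw [Set.indicator_of_notMem (fun h => h3 h.2), Nat.sub_eq_zero_of_le (by omega)]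
          simp
      · rw [Set.indicator_of_notMem (fun h => hω h.1), Set.indicator_of_notMem hω, zero_mul]
    rw [← lintegral_indicator hE, lintegral_congr h2]
    have hind := indepFun_of_past (stat hp) p (f := A.indicator (1 : (ℕ → ℕ) → ℝ≥0∞)) (n := b)
      fun ω ω' h => by
        by_cases hω : ω ∈ A
        · rw [Set.indicator_of_mem hω, Set.indicator_of_mem ((hA ω ω' h).1 hω)]; rfl
        · rw [Set.indicator_of_notMem hω, Set.indicator_of_notMem fun h' => hω ((hA ω ω' h).2 h')]
    have hg : Measurable fun k : ℕ => ((k - a : ℕ) : ℝ≥0∞) := .of_discrete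
    have hind2 := hind.comp measurable_id hg
    have h4 := lintegral_mul_eq_lintegral_mul_lintegral_of_indepFun
      (measurable_one.indicator hAm) (hg.comp (measurable_pi_apply (b + 1))) hind2
    refine h4.trans ?_
    rw [lintegral_indicator_one hAm]
    congr 1
    have h5 := lintegral_map (μ := inputs (stat hp) p) hg (measurable_pi_apply (b + 1))
    refine h5.symm.trans ?_
    have h6 := map_eval_inputs (stat hp) p (b + 1)
    refine (congrArg (fun ν => ∫⁻ k, ((k - a : ℕ) : ℝ≥0∞) ∂ν) h6).trans ?_
    rw [lintegral_countable']
    refine tsum_congr fun k => ?_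
    rw [PMF.toMeasure_apply_singleton _ _ .of_discrete]
    rfl
  rw [theta, ProbabilityTheory.cond, lintegral_smul_measure, hint, hC, smul_eq_mul]
  rw [hC] at hpos
  have hA1 : inputs (stat hp) p A ≠ 0 := left_ne_zero_of_mul hpos
  rw [ENNReal.mul_inv (.inl hA1) (.inl (measure_ne_top _ _))]
  calc _ = ((inputs (stat hp) p A)⁻¹ * inputs (stat hp) p A)
        * ((∑' k, ((k - a : ℕ) : ℝ≥0∞) * p k) * (tail p a)⁻¹) := by ring
    _ = _ := by
      rw [ENNReal.inv_mul_cancel hA1 (measure_ne_top _ _), one_mul, ENNReal.div_eq_inv_mul,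
        mul_comm]

end

section

/-! ### Comparison of two chains on a finite time horizon -/

lemma step_mono {p p' : PMF ℕ} {c : ℝ≥0∞} (hc : c ≤ 1) (h : ∀ k, c * p' k ≤ p k) (i j : ℕ) :
    c * step p' i j ≤ step p i j := by
  cases i with
  | zero => exact h j
  | succ i =>
    simp only [step]
    split_ifs
    · simpa using hc
    · simp

/-- Each path up to `T` is a product of `T` transition probabilities, and each of them loses at most
a factor `c`. As the paths in `S` start at `0`, the initial laws enter only through their masses at
`0`, which are multiplied crosswise. -/
lemma chainLaw_comparison {p p' : PMF ℕ} (hp : ∑' k : ℕ, (k : ℝ≥0∞) * p k < ∞)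
    (hp' : ∑' k : ℕ, (k : ℝ≥0∞) * p' k < ∞) {c : ℝ≥0∞} (hc : c ≤ 1)
    (h : ∀ k, c * p' k ≤ p k) {T : ℕ} {S : Set (ℕ → ℕ)}
    (hS : ∀ m m' : ℕ → ℕ, (∀ i ≤ T, m i = m' i) → (m ∈ S ↔ m' ∈ S)) (hS0 : ∀ m ∈ S, m 0 = 0) :
    stat hp 0 * (c ^ T * chainLaw hp' S) ≤ stat hp' 0 * chainLaw hp S := by
  let r : (ℕ → ℕ) → Fin (T + 1) → ℕ := fun m i => m i
  -- The value `0` after time `T` is immaterial, because `S` depends only on times up to `T`.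
  let e : (Fin (T + 1) → ℕ) → ℕ → ℕ := fun w i => if h : i < T + 1 then w ⟨i, h⟩ else 0
  have hr : Measurable r := measurable_pi_lambda _ fun i => measurable_pi_apply _
  have hpre : r ⁻¹' {w | e w ∈ S} = S := by
    ext m
    refine (hS _ _ fun i hi => ?_)
    simp only [e, r]
    rw [dif_pos (by omega)]
  have hsingle : ∀ w, r ⁻¹' {w} = {m | ∀ i ≤ T, m i = e w i} := by
    intro w
    ext m
    constructor
    · rintro rfl i hi
      simp only [e, r]
      rw [dif_pos (by omega)]
    · intro hm
      funext i
      have := hm i (by omega)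
      simp only [e] at this
      rwa [dif_pos i.2] at this
  have hsum : ∀ {q : PMF ℕ} (hq : ∑' k : ℕ, (k : ℝ≥0∞) * q k < ∞), chainLaw hq S
      = ∑' w, {w | e w ∈ S}.indicator
        (fun w => stat hq (e w 0) * ∏ i ∈ Finset.range T, step q (e w i) (e w (i + 1))) w := by
    intro q hq
    conv_lhs => rw [← hpre, ← Measure.map_apply hr .of_discrete,
      ← Measure.tsum_indicator_apply_singleton _ _ .of_discrete]
    refine tsum_congr fun w => ?_
    congr 1
    funext w
    rw [Measure.map_apply hr .of_discrete, hsingle, chainLaw_cylinder]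
  rw [hsum hp, hsum hp', ← ENNReal.tsum_mul_left, ← ENNReal.tsum_mul_left, ← ENNReal.tsum_mul_left]
  refine ENNReal.tsum_le_tsum fun w => ?_
  by_cases hw : e w ∈ S
  · rw [Set.indicator_of_mem (by exact hw), Set.indicator_of_mem (by exact hw), hS0 _ hw]
    have hprod : c ^ T * ∏ i ∈ Finset.range T, step p' (e w i) (e w (i + 1))
        ≤ ∏ i ∈ Finset.range T, step p (e w i) (e w (i + 1)) := by
      have h2 : c ^ T = ∏ _i ∈ Finset.range T, c := by simp
      rw [h2, ← Finset.prod_mul_distrib]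
      exact Finset.prod_le_prod' fun i _ => step_mono hc h _ _
    calc _ = stat hp 0 * stat hp' 0
          * (c ^ T * ∏ i ∈ Finset.range T, step p' (e w i) (e w (i + 1))) := by ring
      _ ≤ stat hp 0 * stat hp' 0 * ∏ i ∈ Finset.range T, step p (e w i) (e w (i + 1)) := by
        gcongr
      _ = _ := by ring
  · rw [Set.indicator_of_notMem (by exact hw), Set.indicator_of_notMem (by exact hw)]
    simp

/-! ### The number of long runs -/

variable (μ p : PMF ℕ) (a : ℕ)

/-- The centred indicator that a run of length at least `a` is drawn at time `s`. -/
def incr (s : ℕ) (ω : ℕ → ℕ) : ℝ :=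
  (if chain ω s = 0 then 1 else 0) * ((if a ≤ ω (s + 1) then 1 else 0) - (tail p a).toReal)

lemma tail_le_one : (tail p a).toReal ≤ 1 := by
  rw [← toMeasure_Ici]
  exact ENNReal.toReal_le_of_le_ofReal zero_le_one (by simpa using prob_le_one)

lemma abs_incr_le (s : ℕ) (ω : ℕ → ℕ) : |incr p a s ω| ≤ 1 := by
  have h1 := tail_le_one p a
  have h2 : 0 ≤ (tail p a).toReal := ENNReal.toReal_nonneg
  unfold incr
  split_ifs <;> rw [abs_le] <;> constructor <;> linarith

lemma incr_congr {t s : ℕ} (hs : s < t) {ω ω' : ℕ → ℕ} (h : ∀ i ≤ t, ω i = ω' i) :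
    incr p a s ω = incr p a s ω' := by
  rw [incr, incr, chain_congr fun i hi => h i (by omega), h (s + 1) hs]

/-- The increments are martingale differences bounded by 1, so the cross terms vanish and the second
moment grows by at most 1 per step. -/
lemma integral_sq_sum_incr (t : ℕ) :
    ∫ ω, (∑ s ∈ Finset.range t, incr p a s ω) ^ 2 ∂(inputs μ p) ≤ t := by
  have hbdd : ∀ t ω, |∑ s ∈ Finset.range t, incr p a s ω| ≤ t := fun t ω =>
    (Finset.abs_sum_le_sum_abs _ _).trans
      ((Finset.sum_le_sum fun s _ => abs_incr_le p a s ω).trans (by simp))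
  have hpast : ∀ (t : ℕ) (ω ω' : ℕ → ℕ), (∀ i ≤ t, ω i = ω' i) →
      ∑ s ∈ Finset.range t, incr p a s ω = ∑ s ∈ Finset.range t, incr p a s ω' :=
    fun t ω ω' h => Finset.sum_congr rfl fun s hs => incr_congr p a (Finset.mem_range.1 hs) h
  have hmeas : ∀ t, Measurable fun ω => ∑ s ∈ Finset.range t, incr p a s ω :=
    fun t => measurable_of_past (hpast t)
  have hincr : ∀ t, Measurable (incr p a t) := fun t =>
    measurable_of_past (n := t + 1) fun ω ω' h => incr_congr p a (Nat.lt_succ_self t) h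
  have hint : ∀ {f : (ℕ → ℕ) → ℝ} (_ : Measurable f) (C : ℝ) (_ : ∀ ω, |f ω| ≤ C),
      Integrable f (inputs μ p) := fun hf C hC =>
    Integrable.of_bound hf.aestronglyMeasurable C (.of_forall hC)
  induction t with
  | zero => simp
  | succ t ih =>
    set S : (ℕ → ℕ) → ℝ := fun ω => ∑ s ∈ Finset.range t, incr p a s ω with hS
    let U : (ℕ → ℕ) → ℝ := fun ω => S ω * if chain ω t = 0 then 1 else 0
    let g : ℕ → ℝ := fun k => (if a ≤ k then 1 else 0) - (tail p a).toReal
    have hU : ∀ ω ω' : ℕ → ℕ, (∀ i ≤ t, ω i = ω' i) → U ω = U ω' := by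
      intro ω ω' h
      simp only [U, hS]
      rw [hpast t ω ω' h, chain_congr h]
    have hind := (indepFun_of_past μ p hU).comp measurable_id (ψ := g) .of_discrete
    have hg : Measurable (fun ω : ℕ → ℕ => g (ω (t + 1))) :=
      (Measurable.of_discrete (f := g)).comp (measurable_pi_apply _)
    -- The factor `g` of the next input has mean zero and is independent of `U`, which depends on
    -- the past.
    have hcross : ∫ ω, S ω * incr p a t ω ∂(inputs μ p) = 0 := by
      have h1 := hind.integral_mul_eq_mul_integral
        (measurable_of_past hU).aestronglyMeasurable hg.aestronglyMeasurable
      have h2 : ∫ ω, g (ω (t + 1)) ∂(inputs μ p) = 0 := by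
        have h3 := integral_map (μ := inputs μ p) (f := g)
          (measurable_pi_apply (t + 1)).aemeasurable
          (Measurable.of_discrete (f := g)).aestronglyMeasurable
        refine h3.symm.trans ?_
        have h4 := map_eval_inputs μ p (t + 1)
        refine (congrArg (fun ν => ∫ k, g k ∂ν) h4).trans ?_
        simp only [inputPMF, g]
        rw [integral_sub, integral_const]
        · have h5 : (fun k : ℕ => if a ≤ k then (1 : ℝ) else 0) = {k | a ≤ k}.indicator 1 := by
            funext k; simp [Set.indicator_apply]
          rw [h5, integral_indicator_one .of_discrete, measureReal_def, toMeasure_Ici]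
          simp
        · refine Integrable.of_bound Measurable.of_discrete.aestronglyMeasurable 1
            (.of_forall fun k => ?_)
          split_ifs <;> simp
        · exact integrable_const _
      have h6 : ∀ ω, S ω * incr p a t ω = U ω * g (ω (t + 1)) := fun ω => by
        simp only [U, g, incr]; ring
      rw [integral_congr_ae (.of_forall h6)]
      refine h1.trans ?_
      exact (congrArg (_ * ·) h2).trans (mul_zero _)
    have hexp : ∀ ω, (∑ s ∈ Finset.range (t + 1), incr p a s ω) ^ 2
        = (S ω ^ 2 + 2 * (S ω * incr p a t ω)) + incr p a t ω ^ 2 := fun ω => by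
      rw [Finset.sum_range_succ]; ring
    have i1 : Integrable (fun ω => S ω ^ 2) (inputs μ p) :=
      hint ((hmeas t).pow_const 2) ((t : ℝ) ^ 2) fun ω => by
        rw [abs_pow]; exact pow_le_pow_left₀ (abs_nonneg _) (hbdd t ω) 2
    have i2 : Integrable (fun ω => S ω * incr p a t ω) (inputs μ p) :=
      hint ((hmeas t).mul (hincr t)) (t * 1) fun ω => by
        rw [abs_mul]
        exact mul_le_mul (hbdd t ω) (abs_incr_le p a t ω) (abs_nonneg _) (by positivity)
    have i3 : Integrable (fun ω => incr p a t ω ^ 2) (inputs μ p) :=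
      hint ((hincr t).pow_const 2) 1 fun ω => by
        rw [abs_pow]; exact pow_le_one₀ (abs_nonneg _) (abs_incr_le p a t ω)
    have h3 : ∫ ω, incr p a t ω ^ 2 ∂(inputs μ p) ≤ 1 := by
      have := integral_mono i3 (integrable_const (1 : ℝ)) fun ω => by
        have := abs_incr_le p a t ω
        exact (sq_le_one_iff_abs_le_one _).2 this
      simpa using this
    have h4 := integral_add (f := fun ω => S ω ^ 2 + 2 * (S ω * incr p a t ω))
      (i1.add (i2.const_mul 2)) i3
    rw [integral_congr_ae (.of_forall hexp), h4,
      integral_add i1 (i2.const_mul 2), integral_const_mul, hcross]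
    push_cast
    linarith

/-- Chebyshev's inequality with the second moment bound `t`. -/
lemma measure_sum_incr_le {t : ℕ} (ht : 0 < t) {ε : ℝ} (hε : 0 < ε) :
    (inputs μ p).real {ω | ∑ s ∈ Finset.range t, incr p a s ω ≤ -(ε * t)}
      ≤ 1 / (ε ^ 2 * t) := by
  have hint : Integrable (fun ω => (∑ s ∈ Finset.range t, incr p a s ω) ^ 2) (inputs μ p) := by
    refine Integrable.of_bound (C := (t : ℝ) ^ 2) ?_ (.of_forall fun ω => ?_)
    · refine Measurable.aestronglyMeasurable (measurable_of_past (n := t) fun ω ω' h => ?_)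
      rw [Finset.sum_congr rfl fun s hs => incr_congr p a (Finset.mem_range.1 hs) h]
    · rw [Real.norm_eq_abs, abs_pow]
      refine pow_le_pow_left₀ (abs_nonneg _) ?_ 2
      exact (Finset.abs_sum_le_sum_abs _ _).trans
        ((Finset.sum_le_sum fun s _ => abs_incr_le p a s ω).trans (by simp))
  have h1 := mul_meas_ge_le_integral_of_nonneg (.of_forall fun ω => sq_nonneg _) hint ((ε * t) ^ 2)
  have h2 := h1.trans (integral_sq_sum_incr μ p a t)
  have ht' : (0 : ℝ) < t := by exact_mod_cast ht
  have h3 : (inputs μ p).real {ω | ∑ s ∈ Finset.range t, incr p a s ω ≤ -(ε * t)}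
      ≤ (inputs μ p).real {ω | (ε * t) ^ 2 ≤ (∑ s ∈ Finset.range t, incr p a s ω) ^ 2} := by
    refine measureReal_mono fun ω hω => ?_
    simp only [Set.mem_ofPred_eq] at hω ⊢
    nlinarith [mul_pos hε ht']
  rw [le_div_iff₀ (by positivity)]
  have h4 : t * ((inputs μ p).real {ω | (ε * t) ^ 2 ≤ (∑ s ∈ Finset.range t, incr p a s ω) ^ 2}
      * (ε ^ 2 * t)) ≤ t * 1 := by
    calc _ = (ε * t) ^ 2 * (inputs μ p).real
          {ω | (ε * t) ^ 2 ≤ (∑ s ∈ Finset.range t, incr p a s ω) ^ 2} := by ring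
      _ ≤ _ := by simpa using h2
  exact (mul_le_mul_of_nonneg_right h3 (by positivity)).trans (le_of_mul_le_mul_left h4 ht')

/-- The number of times before `t` at which the chain is at `0`. -/
def zeros (t : ℕ) (ω : ℕ → ℕ) : Finset ℕ := {s ∈ Finset.range t | chain ω s = 0}

/-- The number of times before `t` at which a run of length at least `a` is drawn. -/
def longRuns (t : ℕ) (ω : ℕ → ℕ) : Finset ℕ :=
  {s ∈ Finset.range t | chain ω s = 0 ∧ a ≤ ω (s + 1)}

/-- A zero and the run after it occupy at most `a + 1` times. The term `chain ω t`, the rest of the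
current run, is paid for in advance and makes the induction close. -/
lemma le_card_zeros {ω : ℕ → ℕ} (h0 : chain ω 0 = 0) (hω : ∀ s, ω (s + 1) ≤ a) (t : ℕ) :
    t + chain ω t ≤ (a + 1) * (zeros t ω).card := by
  induction t with
  | zero => simp [h0]
  | succ t ih =>
    rw [zeros, Finset.range_add_one, Finset.filter_insert, chain]
    split_ifs with h
    · rw [Finset.card_insert_of_notMem (by simp), h, next, if_pos rfl]
      have := hω t
      rw [zeros] at ih
      rw [h] at ih
      linarith
    · rw [next, if_neg h]
      rw [zeros] at ih
      omega

lemma sum_incr_eq (t : ℕ) (ω : ℕ → ℕ) : ∑ s ∈ Finset.range t, incr p a s ω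
    = (longRuns a t ω).card - (tail p a).toReal * (zeros t ω).card := by
  have h : ∀ s, incr p a s ω = (if chain ω s = 0 ∧ a ≤ ω (s + 1) then 1 else 0)
      - (tail p a).toReal * if chain ω s = 0 then 1 else 0 := by
    intro s
    unfold incr
    split_ifs <;> simp_all
  rw [Finset.sum_congr rfl fun s _ => h s, Finset.sum_sub_distrib, ← Finset.mul_sum,
    Finset.sum_boole, Finset.sum_boole]
  rfl

lemma le_card_longRuns {ω : ℕ → ℕ} (h0 : chain ω 0 = 0) (hω : ∀ s, ω (s + 1) ≤ a) {t : ℕ} {ρ : ℝ}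
    (hpos : 0 ≤ ρ) (hρ : ρ * (a + 1) ≤ (tail p a).toReal)
    (hS : -(ρ / 2 * t) < ∑ s ∈ Finset.range t, incr p a s ω) :
    ρ / 2 * t < (longRuns a t ω).card := by
  rw [sum_incr_eq] at hS
  have h1 : (t : ℝ) ≤ (a + 1) * (zeros t ω).card := by
    have := le_card_zeros a h0 hω t
    exact_mod_cast (Nat.le_add_right _ _).trans this
  have h2 : ρ * t ≤ (tail p a).toReal * (zeros t ω).card := by
    calc ρ * t ≤ ρ * ((a + 1) * (zeros t ω).card) := by gcongr
      _ = ρ * (a + 1) * (zeros t ω).card := by ring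
      _ ≤ _ := by gcongr
  linarith

end

section

/-! ### Stopping times of full density meet every age of positive frequency -/

/-- With `k = ⌊T / (1 + ε)⌋` one has `f k < (1 + ε) k ≤ T`, so the first `k + 1` values lie below
`T`; moreover `(1 - ε)(1 + ε) ≤ 1`. -/
lemma eventually_dense {f : ℕ → ℕ∞} (hf : StrictMono f)
    (hlim : Tendsto (fun n : ℕ => (f n : ℝ≥0∞) / (n : ℝ≥0∞)) atTop (𝓝 1)) {ε : ℝ} (hε : 0 < ε) :
    ∀ᶠ T : ℕ in atTop, ∃ K : ℕ, (1 - ε) * T ≤ K ∧ ∀ n < K, f n < T := by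
  have h1 : (1 : ℝ≥0∞) < ENNReal.ofReal (1 + ε) := by
    rw [← ENNReal.ofReal_one]
    exact (ENNReal.ofReal_lt_ofReal_iff (by linarith)).2 (by linarith)
  have h2 := (hlim.eventually_lt_const h1).and (eventually_ge_atTop 1)
  have h3 : Tendsto (fun T : ℕ => ⌊(T : ℝ) / (1 + ε)⌋₊) atTop atTop :=
    tendsto_nat_floor_atTop.comp
      (tendsto_natCast_atTop_atTop.atTop_div_const (by linarith))
  filter_upwards [h3.eventually h2] with T hT
  set k := ⌊(T : ℝ) / (1 + ε)⌋₊ with hk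
  have hk1 : (0 : ℝ) < k := by exact_mod_cast hT.2
  have h4 : (f k : ℝ≥0∞) < T := by
    have h5 := (ENNReal.div_lt_iff (.inl (by exact_mod_cast hk1.ne')) (.inl (by simp))).1 hT.1
    refine h5.trans_le ?_
    rw [← ENNReal.ofReal_natCast, ← ENNReal.ofReal_mul (by linarith), ← ENNReal.ofReal_natCast]
    refine ENNReal.ofReal_le_ofReal ?_
    have h6 : (k : ℝ) ≤ T / (1 + ε) := Nat.floor_le (by positivity)
    rw [le_div_iff₀ (by linarith)] at h6
    linarith
  have h7 : f k < T := by exact_mod_cast h4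
  refine ⟨k + 1, ?_, fun n hn => (hf.monotone (Nat.lt_succ_iff.1 hn)).trans_lt h7⟩
  have h8 : (T : ℝ) / (1 + ε) < k + 1 := Nat.lt_floor_add_one _
  push_cast
  refine le_trans ?_ h8.le
  rw [le_div_iff₀ (by linarith)]
  nlinarith [mul_nonneg (sq_nonneg ε) (Nat.cast_nonneg (α := ℝ) T)]

/-- Pigeonhole: the values `f n` with `j ≤ n < K` are distinct and lie below `T`, which leaves too
little room to avoid `V`. -/
lemma exists_eq_of_card {f : ℕ → ℕ∞} (hf : StrictMono f) {T K j : ℕ} (hK : ∀ n < K, f n < T)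
    {V : Finset ℕ} (hV : V ⊆ Finset.range T) (hcard : T + j < K + V.card) :
    ∃ n ≥ j, ∃ v ∈ V, f n = (v : ℕ∞) := by
  by_contra! hne
  have hcoe : ∀ n ∈ Finset.Ico j K, ((f n).toNat : ℕ∞) = f n := fun n hn =>
    ENat.natCast_toNat (ne_top_of_lt (hK n (Finset.mem_Ico.1 hn).2))
  have hinj : Set.InjOn (fun n => (f n).toNat) (Finset.Ico j K) := by
    intro n hn n' hn' h
    apply hf.injective
    rw [← hcoe n hn, ← hcoe n' hn']
    exact congrArg _ h
  have hdisj : Disjoint ((Finset.Ico j K).image fun n => (f n).toNat) V := by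
    rw [Finset.disjoint_left]
    intro v hv hv'
    obtain ⟨n, hn, rfl⟩ := Finset.mem_image.1 hv
    exact hne n (Finset.mem_Ico.1 hn).1 _ hv' (hcoe n hn).symm
  have hsub : ((Finset.Ico j K).image fun n => (f n).toNat) ∪ V ⊆ Finset.range T := by
    refine Finset.union_subset (fun v hv => ?_) hV
    obtain ⟨n, hn, rfl⟩ := Finset.mem_image.1 hv
    have h1 := hK n (Finset.mem_Ico.1 hn).2
    rw [← hcoe n hn] at h1
    exact Finset.mem_range.2 (by exact_mod_cast h1)
  have h := Finset.card_le_card hsub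
  rw [Finset.card_union_of_disjoint hdisj, Finset.card_image_of_injOn hinj, Nat.card_Ico,
    Finset.card_range] at h
  omega

/-- Paths for which some `lam n` with `n ≥ j` stops before time `T` at age `a` (the time since the
last zero), with an observation satisfying `Φ`. -/
def hits (lam : ℕ → Path → ℕ∞) (j a T : ℕ) (Φ : ℕ → (k : ℕ) → (Fin (k + 1) → Fin 2) → Prop) :
    Set Path :=
  {x | ∃ n ≥ j, ∃ b, b + a ≤ T ∧ lam n x = ((b + a : ℕ) : ℕ∞) ∧ x b = 0 ∧
    (∀ i, b < i → i ≤ b + a → x i = 1) ∧ Φ n (b + a) (observed (b + a) x)}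

/-- An event of `σ(X_0, …, X_t)` is a preimage under restriction to the times up to `t`. -/
lemma stopping_congr {τ : Path → ℕ∞} (hτ : IsStoppingTime pathFiltration τ) {t : ℕ} {x y : Path}
    (hxy : ∀ i ≤ t, x i = y i) (hx : τ x = t) : τ y = t := by
  have hmeas : MeasurableSet[pathFiltration t] {x | τ x = t} := hτ.measurableSet_eq t
  obtain ⟨s, -, hs⟩ := hmeas
  have h1 : x ∈ {x | τ x = t} := hx
  have h2 : Preorder.restrictLe (π := fun _ : ℕ => Fin 2) t x = Preorder.restrictLe t y := by
    funext i
    exact hxy i i.2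
  rw [← hs] at h1
  have h3 : y ∈ {x | τ x = t} := by
    rw [← hs, Set.mem_preimage, ← h2]
    exact h1
  exact h3

lemma observed_congr {t : ℕ} {x y : Path} (hxy : ∀ i ≤ t, x i = y i) :
    observed t x = observed t y := by
  funext i
  exact hxy i (by omega)

lemma hits_congr {lam : ℕ → Path → ℕ∞} (hlam : ∀ n, IsStoppingTime pathFiltration (lam n))
    {j a T : ℕ} {Φ : ℕ → (k : ℕ) → (Fin (k + 1) → Fin 2) → Prop} {x y : Path}
    (hxy : ∀ i ≤ T, x i = y i) (hx : x ∈ hits lam j a T Φ) : y ∈ hits lam j a T Φ := by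
  obtain ⟨n, hn, b, hb, h1, h2, h3, h4⟩ := hx
  refine ⟨n, hn, b, hb, stopping_congr (hlam n) (fun i hi => hxy i (by omega)) h1, ?_, ?_, ?_⟩
  · rw [← hxy b (by omega)]; exact h2
  · intro i hi hi'
    rw [← hxy i (by omega)]; exact h3 i hi hi'
  · rwa [← observed_congr fun i hi => hxy i (by omega)]

lemma ae_inputs_le {μ p : PMF ℕ} {a : ℕ} (ha : ∀ k, a < k → p k = 0) :
    ∀ᵐ ω ∂(inputs μ p), ∀ s : ℕ, ω (s + 1) ≤ a := by
  rw [ae_all_iff]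
  intro s
  have h := inputs_inter_next μ p (n := s) (A := Set.univ) (by simp) {k | a < k}
  rw [ae_iff]
  simp only [not_le]
  rw [Set.univ_inter, measure_univ, one_mul] at h
  refine h.trans ?_
  rw [PMF.toMeasure_apply_eq_zero_iff _ .of_discrete, Set.disjoint_left]
  intro k hk hk'
  exact hk (ha k hk')

variable {p : PMF ℕ} (hp : ∑' k : ℕ, (k : ℝ≥0∞) * p k < ∞)

lemma inputs_chain_zero :
    (inputs (stat hp) p).real {ω | chain ω 0 ≠ 0} = 1 - (stat hp 0).toReal := by
  have h1 := chain_markov (stat hp) p 0 fun _ => 0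
  simp only [Nat.le_zero, forall_eq, Finset.range_zero, Finset.prod_empty, mul_one] at h1
  have hm : MeasurableSet {ω : ℕ → ℕ | chain ω 0 = 0} :=
    (measurable_pi_apply 0) (MeasurableSet.of_discrete (s := {0}))
  have h2 := probReal_compl_eq_one_sub (μ := inputs (stat hp) p) hm
  rw [measureReal_def, measureReal_def, h1] at h2
  exact h2

/-- From a zero start, runs of length `a` begin at a positive fraction of all times, whereas the
stopping times miss only a smaller fraction; the two sets must meet, even after the first `j`
indices are discarded. -/
lemma exists_hits {lam : ℕ → Path → ℕ∞}
    (hmono : ∀ᵐ x ∂(renewalLaw hp), StrictMono fun n => lam n x)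
    (hlim : ∀ᵐ x ∂(renewalLaw hp),
      Tendsto (fun n : ℕ => (lam n x : ℝ≥0∞) / (n : ℝ≥0∞)) atTop (𝓝 1))
    {a : ℕ} (ha : ∀ k, a < k → p k = 0) (ha' : p a ≠ 0) (j : ℕ) :
    ∃ T, stat hp 0 / 2
      ≤ chainLaw hp {m | m 0 = 0 ∧ collapse m ∈ hits lam j a T fun _ _ _ => True} := by
  set ν := inputs (stat hp) p with hν
  have htail : 0 < (tail p a).toReal := by
    have h1 : tail p a ≠ 0 := by
      rw [tail_succ]
      exact fun h => ha' (add_eq_zero.1 h).1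
    refine ENNReal.toReal_pos h1 ?_
    rw [← toMeasure_Ici]; exact measure_ne_top _ _
  set ρ : ℝ := (tail p a).toReal / (a + 1) with hρ
  have hρ0 : 0 < ρ := by positivity
  have hρ1 : ρ * (a + 1) ≤ (tail p a).toReal := (div_mul_cancel₀ _ (by positivity)).le
  have hs0 : 0 < (stat hp 0).toReal :=
    ENNReal.toReal_pos (stat_zero_pos hp).ne' (PMF.apply_ne_top _ _)
  set σ : ℝ := (stat hp 0).toReal with hσ
  have hmap : renewalLaw hp = ν.map fun ω => collapse (chain ω) :=
    Measure.map_map measurable_collapse measurable_chain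
  have hmeas : Measurable fun ω => collapse (chain ω) := measurable_collapse.comp measurable_chain
  rw [hmap] at hmono hlim
  replace hmono := ae_of_ae_map hmeas.aemeasurable hmono
  replace hlim := ae_of_ae_map hmeas.aemeasurable hlim
  -- Almost sure density is made uniform: the sets `C T₀` increase to an almost sure event.
  let C : ℕ → Set (ℕ → ℕ) := fun T₀ => {ω | ∀ T ≥ T₀, ∃ K : ℕ, (1 - ρ / 8) * T ≤ K ∧
    ∀ n < K, lam n (collapse (chain ω)) < (T : ℕ∞)}
  have hCmono : Monotone C := fun T T' h ω hω S hS => hω S (h.trans hS)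
  have hCunion : ν (⋃ T, C T) = 1 := by
    rw [← measure_univ (μ := ν)]
    refine measure_congr (Filter.eventuallyEq_set.2 ?_)
    filter_upwards [hmono, hlim] with ω h1 h2
    simp only [Set.mem_iUnion, Set.mem_univ, iff_true]
    exact eventually_atTop.1 (eventually_dense h1 h2 (by positivity : 0 < ρ / 8))
  obtain ⟨T₀, hT₀⟩ : ∃ T₀, 1 - σ / 4 < ν.real (C T₀) := by
    rw [hCmono.measure_iUnion] at hCunion
    have h1 : ENNReal.ofReal (1 - σ / 4) < ⨆ T, ν (C T) := by
      rw [hCunion, ← ENNReal.ofReal_one]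
      exact (ENNReal.ofReal_lt_ofReal_iff one_pos).2 (by linarith)
    obtain ⟨T₀, h2⟩ := lt_iSup_iff.1 h1
    have hσ1 : σ ≤ 1 := ENNReal.toReal_le_of_le_ofReal zero_le_one (by
      simpa using PMF.coe_le_one (stat hp) 0)
    exact ⟨T₀, (ENNReal.ofReal_lt_iff_lt_toReal (by linarith) (measure_ne_top _ _)).1 h2⟩
  -- The stopping times miss at most `ρ / 8 * (t + a)` times below `t + a`, and `j` indices are
  -- discarded. The last inequality makes the sum of these less than the `ρ / 2 * t` long runs.
  have hlarge : ∀ᶠ t : ℕ in atTop, T₀ ≤ t + a ∧ 0 < t ∧ 1 / ((ρ / 2) ^ 2 * t) ≤ σ / 4 ∧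
      ρ / 8 * a + j < 3 * ρ / 8 * t := by
    have h1 : Tendsto (fun t : ℕ => (t : ℝ)) atTop atTop := tendsto_natCast_atTop_atTop
    filter_upwards [eventually_ge_atTop T₀, eventually_gt_atTop 0,
      (h1.const_mul_atTop (show 0 < (ρ / 2) ^ 2 * (σ / 4) by positivity)).eventually_ge_atTop 1,
      (h1.const_mul_atTop (show 0 < 3 * ρ / 8 by positivity)).eventually_gt_atTop
        (ρ / 8 * a + j)] with t h2 h3 h4 h5
    refine ⟨by omega, h3, ?_, h5⟩
    have h6 : (0 : ℝ) < t := by exact_mod_cast h3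
    rw [div_le_iff₀ (by positivity)]
    linarith
  obtain ⟨t, ht1, ht2, ht3, ht4⟩ := hlarge.exists
  refine ⟨t + a, ?_⟩
  set H : Set (ℕ → ℕ) := {m | m 0 = 0 ∧ collapse m ∈ hits lam j a (t + a) fun _ _ _ => True}
  set B : Set (ℕ → ℕ) := {ω | ∑ s ∈ Finset.range t, incr p a s ω ≤ -(ρ / 2 * t)}
  have hB : ν.real B ≤ σ / 4 := (measure_sum_incr_le _ p a ht2 (by positivity)).trans ht3
  have hsub : C T₀ ≤ᵐ[ν] (chain ⁻¹' H ∪ {ω | chain ω 0 ≠ 0} ∪ B : Set (ℕ → ℕ)) := by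
    filter_upwards [hmono, ae_inputs_le (μ := stat hp) ha] with ω h1 h2 hω
    by_cases h0 : chain ω 0 = 0
    swap
    · exact .inl (.inr h0)
    by_cases hωB : ω ∈ B
    · exact .inr hωB
    refine .inl (.inl ⟨h0, ?_⟩)
    have hlong := le_card_longRuns p a h0 h2 hρ0.le hρ1 (not_le.1 hωB)
    obtain ⟨K, hK1, hK2⟩ := hω (t + a) ht1
    have hcard : t + a + j < K + ((longRuns a t ω).image (· + a)).card := by
      rw [Finset.card_image_of_injective _ (add_left_injective a)]
      have : ((t + a + j : ℕ) : ℝ) < ((K + (longRuns a t ω).card : ℕ) : ℝ) := by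
        push_cast at hK1 ⊢
        linarith
      exact_mod_cast this
    have hV : (longRuns a t ω).image (· + a) ⊆ Finset.range (t + a) := by
      intro v hv
      obtain ⟨s, hs, rfl⟩ := Finset.mem_image.1 hv
      have := Finset.mem_range.1 (Finset.mem_filter.1 hs).1
      exact Finset.mem_range.2 (by simpa using this)
    obtain ⟨n, hn, v, hv, hnv⟩ := exists_eq_of_card h1 hK2 hV hcard
    obtain ⟨s, hs, rfl⟩ := Finset.mem_image.1 hv
    obtain ⟨hs1, hs2, hs3⟩ := Finset.mem_filter.1 hs
    refine ⟨n, hn, s, ?_, hnv, collapse_eq_zero.2 hs2, (run_iff hs2 a).2 hs3, trivial⟩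
    have := Finset.mem_range.1 hs1
    omega
  -- The left side exceeds `1 - σ / 4` and `B` costs at most `σ / 4`, which leaves `σ / 2` for the
  -- hits.
  have h1 : ν.real (C T₀) ≤ ν.real (chain ⁻¹' H) + (1 - σ) + ν.real B := by
    have h2 := ENNReal.toReal_mono (measure_ne_top _ _) (measure_mono_ae hsub)
    refine h2.trans ((measureReal_union_le _ _).trans ?_)
    gcongr
    exact (measureReal_union_le _ _).trans (by rw [← inputs_chain_zero hp])
  have h3 : σ / 2 ≤ ν.real (chain ⁻¹' H) := by linarith
  have h4 : stat hp 0 / 2 ≤ ν (chain ⁻¹' H) := by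
    rw [← ENNReal.toReal_le_toReal _ (measure_ne_top _ _), ENNReal.toReal_div]
    · exact h3
    · exact (ENNReal.div_lt_top (PMF.apply_ne_top _ _) (by simp)).ne
  exact h4.trans (Measure.le_map_apply measurable_chain.aemeasurable _)

end

section

/-! ### A complete space of run length distributions -/

/-- The parameter space: summable real sequences with the `ℓ¹` norm. -/
abbrev Param : Type := lp (fun _ : ℕ => ℝ) 1

/-- The unnormalized distribution with parameter `u`. -/
def weight (u : Param) (k : ℕ) : ℝ := |u k| / (k + 1) + if k = 0 then 1 else 0

lemma summable_abs (u : Param) : Summable fun k => |u k| := by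
  have h := (lp.memℓp u).summable (by simp)
  simpa using h

lemma norm_eq_tsum (u : Param) : ‖u‖ = ∑' k, |u k| := by
  have h := lp.norm_eq_tsum_rpow (p := 1) (by simp) u
  simpa using h

lemma weight_nonneg (u : Param) (k : ℕ) : 0 ≤ weight u k := by
  unfold weight; positivity

/-- Sums of the weights against coefficients. -/
def wsum (c : ℕ → ℝ) (u : Param) : ℝ := ∑' k, c k * weight u k

/-- Coefficients growing at most linearly. -/
def Moderate (c : ℕ → ℝ) : Prop := ∀ k, 0 ≤ c k ∧ c k ≤ k + 1

section
variable {c : ℕ → ℝ} (hc : Moderate c)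
include hc

lemma summable_wsum (u : Param) : Summable fun k => c k * weight u k := by
  have h1 : Summable fun k => |u k| + if k = 0 then (1 : ℝ) else 0 :=
    (summable_abs u).add (hasSum_ite_eq 0 (1 : ℝ)).summable
  refine Summable.of_nonneg_of_le (fun k => mul_nonneg (hc k).1 (weight_nonneg u k)) (fun k => ?_) h1
  refine (mul_le_mul_of_nonneg_right (hc k).2 (weight_nonneg u k)).trans (le_of_eq ?_)
  unfold weight
  rw [mul_add, mul_div_cancel₀ _ (by positivity)]
  split_ifs with h <;> simp [h]

/-- The divisor `k + 1` in `weight` absorbs linear growth of `c`, so the sum is even 1-Lipschitz for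
the `ℓ¹` norm. -/
lemma continuous_wsum : Continuous (wsum c) := by
  have h : LipschitzWith 1 (wsum c) := by
    refine LipschitzWith.of_dist_le_mul fun u v => ?_
    rw [Real.dist_eq, dist_eq_norm, norm_eq_tsum, NNReal.coe_one, one_mul, wsum, wsum,
      ← (summable_wsum hc u).tsum_sub (summable_wsum hc v)]
    have hle : ∀ k, |c k * weight u k - c k * weight v k| ≤ |(u - v) k| := by
      intro k
      have h1 : c k * weight u k - c k * weight v k = (c k / (k + 1)) * (|u k| - |v k|) := by
        unfold weight; ring
      rw [h1, abs_mul, abs_of_nonneg (div_nonneg (hc k).1 (by positivity))]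
      have h2 : c k / (k + 1) ≤ 1 := (div_le_one (by positivity)).2 (hc k).2
      exact (mul_le_of_le_one_left (abs_nonneg _) h2).trans (abs_abs_sub_abs_le _ _)
    exact tsum_of_norm_bounded (f := fun k => c k * weight u k - c k * weight v k)
      (summable_abs (u - v)).hasSum hle
  exact h.continuous

lemma wsum_add_single {u : Param} {L : ℕ} (huL : u L = 0) (τ : ℝ) :
    wsum c (u + lp.single 1 L τ) = wsum c u + c L * (|τ| / (L + 1)) := by
  have h : ∀ k, c k * weight (u + lp.single 1 L τ) k
      = c k * weight u k + if k = L then c L * (|τ| / (L + 1)) else 0 := by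
    intro k
    unfold weight
    rw [lp.coeFn_add, Pi.add_apply]
    by_cases hk : k = L
    · subst hk
      rw [lp.single_apply_self, huL, zero_add, abs_zero, zero_div, zero_add, if_pos rfl]
      ring
    · rw [lp.single_apply_ne _ _ _ hk]
      simp [hk]
  rw [wsum, tsum_congr h, (summable_wsum hc u).tsum_add (hasSum_ite_eq L _).summable, tsum_ite_eq]
  rfl

end

lemma moderate_one : Moderate fun _ => 1 := fun k => ⟨zero_le_one, by
  have : (0 : ℝ) ≤ k := k.cast_nonneg
  linarith⟩

lemma moderate_sub (a : ℕ) : Moderate fun k => ((k - a : ℕ) : ℝ) := fun k => ⟨by positivity, by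
  have : ((k - a : ℕ) : ℝ) ≤ k := by exact_mod_cast Nat.sub_le k a
  linarith⟩

lemma moderate_tail (a : ℕ) : Moderate fun k => if a ≤ k then (1 : ℝ) else 0 := fun k => by
  have : (0 : ℝ) ≤ k := k.cast_nonneg
  constructor <;> dsimp only <;> split_ifs <;> linarith

/-- The normalizing constant. -/
def total : Param → ℝ := wsum fun _ => 1

/-- The unnormalized tail. -/
def wtail (a : ℕ) : Param → ℝ := wsum fun k => if a ≤ k then 1 else 0

/-- The unnormalized mean excess over `a`. -/
def excess (a : ℕ) : Param → ℝ := wsum fun k => ((k - a : ℕ) : ℝ)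

lemma continuous_weight (k : ℕ) : Continuous fun u => weight u k := by
  have h : Moderate fun i => if i = k then 1 else 0 := fun i => by
    have : (0 : ℝ) ≤ i := i.cast_nonneg
    constructor <;> dsimp only <;> split_ifs <;> linarith
  have h2 : (fun u => weight u k) = wsum fun i => if i = k then 1 else 0 := by
    funext u
    simp [wsum]
  rw [h2]
  exact continuous_wsum h

/-- The unit mass at `0` ensures this even for `u = 0`. -/
lemma total_pos (u : Param) : 0 < total u := by
  refine (summable_wsum moderate_one u).tsum_pos
    (fun k => mul_nonneg zero_le_one (weight_nonneg u k)) 0 ?_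
  have := abs_nonneg (u 0)
  simp only [weight, if_true]
  positivity

lemma tsum_ofReal_weight {c : ℕ → ℝ} (hc : Moderate c) (u : Param) :
    ∑' k, ENNReal.ofReal (c k) * ENNReal.ofReal (weight u k) = ENNReal.ofReal (wsum c u) := by
  rw [wsum, ENNReal.ofReal_tsum_of_nonneg (fun k => mul_nonneg (hc k).1 (weight_nonneg u k))
    (summable_wsum hc u)]
  exact tsum_congr fun k => (ENNReal.ofReal_mul (hc k).1).symm

lemma tsum_weight (u : Param) :
    ∑' k, ENNReal.ofReal (weight u k) = ENNReal.ofReal (total u) := by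
  simpa [total] using tsum_ofReal_weight moderate_one u

/-- The run length distribution with parameter `u`. -/
def runPMF (u : Param) : PMF ℕ :=
  PMF.normalize (fun k => ENNReal.ofReal (weight u k))
    (by rw [tsum_weight]; simpa using total_pos u) (by rw [tsum_weight]; simp)

lemma runPMF_apply (u : Param) (k : ℕ) :
    runPMF u k = ENNReal.ofReal (weight u k) * (ENNReal.ofReal (total u))⁻¹ := by
  rw [runPMF, PMF.normalize_apply, tsum_weight]

lemma tsum_mul_runPMF {c : ℕ → ℝ} (hc : Moderate c) (u : Param) :
    ∑' k, ENNReal.ofReal (c k) * runPMF u k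
      = ENNReal.ofReal (wsum c u) * (ENNReal.ofReal (total u))⁻¹ := by
  rw [← tsum_ofReal_weight hc, ← ENNReal.tsum_mul_right]
  exact tsum_congr fun k => by rw [runPMF_apply, mul_assoc]

lemma tsum_sub_mul_runPMF (u : Param) (a : ℕ) :
    ∑' k, ((k - a : ℕ) : ℝ≥0∞) * runPMF u k
      = ENNReal.ofReal (excess a u) * (ENNReal.ofReal (total u))⁻¹ := by
  rw [excess, ← tsum_mul_runPMF (moderate_sub a)]
  exact tsum_congr fun k => by rw [ENNReal.ofReal_natCast]

lemma mean_runPMF_lt_top (u : Param) : ∑' k : ℕ, (k : ℝ≥0∞) * runPMF u k < ∞ := by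
  have h := tsum_sub_mul_runPMF u 0
  simp only [Nat.sub_zero] at h
  rw [h]
  refine ENNReal.mul_lt_top (by simp) ?_
  simpa using total_pos u

lemma tail_runPMF (u : Param) (a : ℕ) :
    tail (runPMF u) a = ENNReal.ofReal (wtail a u) * (ENNReal.ofReal (total u))⁻¹ := by
  rw [wtail, ← tsum_mul_runPMF (moderate_tail a), tail]
  refine tsum_congr fun k => ?_
  split_ifs <;> simp

lemma meanResidual_runPMF {u : Param} {a : ℕ} (h : 0 < wtail a u) :
    (∑' k, ((k - a : ℕ) : ℝ≥0∞) * runPMF u k) / tail (runPMF u) a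
      = ENNReal.ofReal (excess a u / wtail a u) := by
  have h0 := ENNReal.ofReal_pos.2 (total_pos u)
  rw [tsum_sub_mul_runPMF, tail_runPMF, ENNReal.mul_div_mul_right _ _
    (by simp) (by simpa using total_pos u), ENNReal.ofReal_div_of_pos h]

/-- Near `v`, run length distributions nearly dominate a finitely supported one below `v`. -/
lemma eventually_dominates {u v : Param} {a : ℕ} (hu : ∀ k, a < k → weight u k = 0)
    (huv : ∀ k, weight u k ≤ weight v k) {c : ℝ} (hc : 0 ≤ c) (hcv : c * total v < total u) :
    ∀ᶠ w in 𝓝 v, ∀ k, ENNReal.ofReal c * runPMF u k ≤ runPMF w k := by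
  -- Only finitely many `k` carry weight under `u`, and for those the inequality is strict at `v`;
  -- so continuity suffices.
  have h1 : ∀ k ∈ Finset.range (a + 1), ∀ᶠ w in 𝓝 v,
      c * weight u k * total w ≤ total u * weight w k := by
    intro k _
    rcases (weight_nonneg u k).eq_or_lt with h | h
    · refine .of_forall fun w => ?_
      rw [← h]
      have := mul_nonneg (total_pos u).le (weight_nonneg w k)
      simpa using this
    · have h2 : c * weight u k * total v < total u * weight v k := by
        calc _ = c * total v * weight u k := by ring
          _ < total u * weight u k := by gcongr
          _ ≤ _ := mul_le_mul_of_nonneg_left (huv k) (total_pos u).le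
      have h3 : Continuous fun w => c * weight u k * total w :=
        continuous_const.mul (continuous_wsum moderate_one)
      have h4 : Continuous fun w => total u * weight w k :=
        continuous_const.mul (continuous_weight k)
      exact (h3.continuousAt.eventually_lt h4.continuousAt h2).mono fun _ => le_of_lt
  filter_upwards [(Filter.eventually_all_finset _).2 h1] with w hw k
  rw [runPMF_apply, runPMF_apply, ← mul_assoc, ← ENNReal.ofReal_mul hc,
    ← ENNReal.ofReal_inv_of_pos (total_pos u), ← ENNReal.ofReal_inv_of_pos (total_pos w),
    ← ENNReal.ofReal_mul (mul_nonneg hc (weight_nonneg u k)),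
    ← ENNReal.ofReal_mul (weight_nonneg w k)]
  refine ENNReal.ofReal_le_ofReal ?_
  rw [← div_eq_mul_inv, ← div_eq_mul_inv, div_le_div_iff₀ (total_pos u) (total_pos w)]
  by_cases hk : k ≤ a
  · rw [mul_comm (weight w k)]
    exact hw k (Finset.mem_range.2 (by omega))
  · rw [hu k (by omega)]
    have := mul_nonneg (weight_nonneg w k) (total_pos u).le
    simpa using this

/-- Finitely supported parameters whose largest run length `a` has positive weight are dense. -/
lemma exists_near_finite (u : Param) {r : ℝ} (hr : 0 < r) :
    ∃ (v : Param) (a : ℕ), dist v u < r ∧ (∀ k, a < k → v k = 0) ∧ 0 < wtail a v ∧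
      excess a v = 0 ∧ wtail a v ≤ r / (a + 1) := by
  have h := lp.hasSum_single (p := 1) (by simp) u
  obtain ⟨s, hs⟩ := ((Metric.tendsto_nhds.1 h) (r / 2) (by positivity)).exists
  set v₀ : Param := ∑ i ∈ s, lp.single 1 i (u i) with hv₀
  -- The `+ 1` puts `a` beyond the support of `v₀` and away from the unit mass at `0`.
  set a := s.sup id + 1 with ha
  have hv0 : ∀ k, a ≤ k → v₀ k = 0 := by
    intro k hk
    rw [hv₀, lp.coeFn_sum, Finset.sum_apply]
    refine Finset.sum_eq_zero fun i hi => ?_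
    have hi' : i ≤ s.sup id := Finset.le_sup (f := id) hi
    rw [lp.single_apply_ne]
    omega
  have hw0 : ∀ k, a ≤ k → weight v₀ k = 0 := by
    intro k hk
    rw [weight, hv0 k hk, if_neg (by omega)]
    simp
  refine ⟨v₀ + lp.single 1 a (r / 3), a, ?_, ?_, ?_⟩
  · have h1 : dist (v₀ + lp.single 1 a (r / 3)) v₀ = r / 3 := by
      rw [dist_eq_norm, add_sub_cancel_left, lp.norm_single (by simp), Real.norm_eq_abs,
        abs_of_pos (by positivity)]
    have h2 := dist_triangle (v₀ + lp.single 1 a (r / 3)) v₀ u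
    linarith
  · intro k hk
    rw [lp.coeFn_add, Pi.add_apply, hv0 k hk.le, lp.single_apply_ne _ _ _ (by omega), zero_add]
  · have h1 : wtail a v₀ = 0 := by
      rw [wtail, wsum]
      refine (tsum_congr fun k => ?_).trans tsum_zero
      by_cases hk : a ≤ k
      · rw [hw0 k hk, mul_zero]
      · rw [if_neg hk, zero_mul]
    have h2 : excess a v₀ = 0 := by
      rw [excess, wsum]
      refine (tsum_congr fun k => ?_).trans tsum_zero
      by_cases hk : a ≤ k
      · rw [hw0 k hk, mul_zero]
      · rw [Nat.sub_eq_zero_of_le (by omega)]; simp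
    have h3 : wtail a (v₀ + lp.single 1 a (r / 3)) = r / 3 / (a + 1) := by
      rw [wtail, wsum_add_single (moderate_tail a) (hv0 a le_rfl)]
      rw [wtail] at h1
      rw [h1, abs_of_pos (by positivity)]
      simp
    refine ⟨?_, ?_, ?_⟩
    · rw [h3]; positivity
    · rw [excess, wsum_add_single (moderate_sub a) (hv0 a le_rfl)]
      rw [excess] at h2
      rw [h2]
      simp
    · rw [h3]; gcongr; linarith

/-- A small amount of mass far out raises the mean excess over `a` without otherwise changing the
distribution much. -/
lemma exists_raised {v : Param} {a : ℕ} (hv : ∀ k, a < k → v k = 0)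
    (hex : excess a v = 0) {r : ℝ} (hr : 0 < r) (htail : wtail a v ≤ r / (a + 1))
    (hpos : 0 < wtail a v) {c : ℝ} (hc : c < 1) :
    ∃ w : Param, dist w v ≤ r ∧ (∀ k, weight v k ≤ weight w k) ∧ c * total w < total v ∧
      3 / 4 < excess a w / wtail a w := by
  -- The coordinate `r` at `L` adds only `r / (L + 1)` to the tail and the total, but `(L - a) * r /
  -- (L + 1)`, which is nearly `r`, to the excess. As `L` grows the ratio tends to `r / wtail a v ≥
  -- a + 1 > 3 / 4`.
  have h0 : Tendsto (fun L : ℕ => r / ((L : ℝ) + 1)) atTop (𝓝 0) :=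
    tendsto_const_nhds.div_atTop (tendsto_atTop_add_const_right _ _ tendsto_natCast_atTop_atTop)
  have h1 : ∀ᶠ L : ℕ in atTop, c * (total v + r / ((L : ℝ) + 1)) < total v := by
    have h2 := (tendsto_const_nhds (x := total v)).add h0 |>.const_mul c
    refine h2.eventually_lt_const ?_
    have := total_pos v
    nlinarith
  have h3 : ∀ᶠ L : ℕ in atTop, 3 / 4 * (wtail a v + r / ((L : ℝ) + 1))
      < r - (a + 1) * (r / ((L : ℝ) + 1)) := by
    have h4 := ((tendsto_const_nhds (x := wtail a v)).add h0).const_mul (3 / 4)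
    have h5 := (tendsto_const_nhds (x := r)).sub (h0.const_mul ((a : ℝ) + 1))
    refine h4.eventually_lt h5 ?_
    have h6 : r / ((a : ℝ) + 1) ≤ r / 1 := by
      gcongr; have : (0 : ℝ) ≤ a := a.cast_nonneg
      linarith
    linarith
  obtain ⟨L, hL1, hL3, hLa⟩ := (h1.and (h3.and (eventually_gt_atTop a))).exists
  have hvL := hv L hLa
  have hL0 : (0 : ℝ) < (L : ℝ) + 1 := by positivity
  refine ⟨v + lp.single 1 L r, ?_, ?_, ?_, ?_⟩
  · rw [dist_eq_norm, add_sub_cancel_left, lp.norm_single (by simp), Real.norm_eq_abs,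
      abs_of_pos hr]
  · intro k
    have h : |v k| ≤ |(v + lp.single 1 L r : Param) k| := by
      rw [lp.coeFn_add, Pi.add_apply]
      by_cases hk : k = L
      · subst hk; rw [hvL, abs_zero]; exact abs_nonneg _
      · rw [lp.single_apply_ne _ _ _ hk, add_zero]
    exact add_le_add_left (div_le_div_of_nonneg_right h (by positivity)) _
  · rw [total, wsum_add_single moderate_one hvL, abs_of_pos hr, one_mul]
    exact hL1
  · have e1 : wtail a (v + lp.single 1 L r) = wtail a v + r / (L + 1) := by
      rw [wtail, wsum_add_single (moderate_tail a) hvL, abs_of_pos hr, if_pos hLa.le, one_mul]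
    have e2 : excess a (v + lp.single 1 L r) = r - (a + 1) * (r / (L + 1)) := by
      rw [excess, wsum_add_single (moderate_sub a) hvL, abs_of_pos hr]
      rw [excess] at hex
      rw [hex, Nat.cast_sub hLa.le]
      field_simp
      ring
    rw [e1, e2, lt_div_iff₀ (by positivity)]
    exact hL3

end

section

/-! ### Estimators err somewhere on an open dense set of parameters -/

/-- The stationary binary renewal process with parameter `u`. -/
def paramLaw (u : Param) : Measure Path := renewalLaw (mean_runPMF_lt_top u)

instance (u : Param) : IsProbabilityMeasure (paramLaw u) := by
  unfold paramLaw; infer_instance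

/-- The probability of a zero. -/
def zeroProb (u : Param) : ℝ≥0∞ := stat (mean_runPMF_lt_top u) 0

lemma zeroProb_pos (u : Param) : 0 < zeroProb u := stat_zero_pos _

lemma zeroProb_ne_top (u : Param) : zeroProb u ≠ ∞ := PMF.apply_ne_top _ _

/-- There are finitely many cylinders of each length, so the null ones can be discarded. On the rest
`theta` is a genuine conditional mean. -/
lemma ae_cylinder_ne_zero (P : Measure Path) :
    ∀ᵐ x ∂P, ∀ n, P {y | ∀ i ≤ n, y i = x i} ≠ 0 := by
  rw [ae_all_iff]
  intro n
  have hobs : ∀ x y : Path, observed n y = observed n x ↔ ∀ i ≤ n, y i = x i := by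
    intro x y
    constructor
    · intro h i hi
      exact congrFun h ⟨i, by omega⟩
    · exact fun h => observed_congr h
  rw [ae_iff]
  refine measure_mono_null (t := ⋃ w ∈ {w | P (observed n ⁻¹' {w}) = 0}, observed n ⁻¹' {w})
    (fun x hx => ?_) ((measure_biUnion_null_iff (Set.to_countable _)).2 fun w hw => hw)
  simp only [Set.mem_ofPred_eq, not_not] at hx
  refine Set.mem_biUnion (x := observed n x) ?_ rfl
  refine Eq.trans ?_ hx
  congr 1
  ext y
  exact hobs x y

variable (lam : ℕ → Path → ℕ∞) (h : ℕ → (k : ℕ) → (Fin (k + 1) → Fin 2) → ℝ)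

/-- The paths on which some estimate with index at least `j` is off by at least `1 / 4`. -/
def bad (P : Measure Path) (j : ℕ) : Set Path :=
  {x | ∃ n ≥ j, ∃ t : ℕ, lam n x = t ∧
    ENNReal.ofReal (1 / 4) ≤ (((h n t (observed t x) : ℝ) : EReal) - (theta P t x : EReal)).abs}

variable {lam h}

lemma measurableSet_bad (hlam : ∀ n, IsStoppingTime pathFiltration (lam n)) (P : Measure Path)
    (j : ℕ) : MeasurableSet (bad lam h P j) := by
  have heq : bad lam h P j = ⋃ n ≥ j, ⋃ t : ℕ, {x | lam n x = t ∧ ENNReal.ofReal (1 / 4)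
      ≤ (((h n t (observed t x) : ℝ) : EReal) - (theta P t x : EReal)).abs} := by
    ext x
    simp [bad]
  rw [heq]
  refine MeasurableSet.iUnion fun n => MeasurableSet.iUnion fun _ => MeasurableSet.iUnion fun t => ?_
  have key : ∀ x y : Path, (∀ i ≤ t, x i = y i) → lam n x = t ∧ ENNReal.ofReal (1 / 4)
      ≤ (((h n t (observed t x) : ℝ) : EReal) - (theta P t x : EReal)).abs →
      lam n y = t ∧ ENNReal.ofReal (1 / 4)
        ≤ (((h n t (observed t y) : ℝ) : EReal) - (theta P t y : EReal)).abs := by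
    rintro x y hxy ⟨h1, h2⟩
    refine ⟨stopping_congr (hlam n) hxy h1, ?_⟩
    have h3 : theta P t y = theta P t x := by
      unfold theta
      congr 2
      ext z
      exact forall₂_congr fun i hi => by rw [hxy i hi]
    rwa [← observed_congr hxy, h3]
  exact measurableSet_of_past (n := t) fun x y hxy =>
    ⟨key x y hxy, key y x fun i hi => (hxy i hi).symm⟩

/-- If the law with parameter `v` gives the hits satisfying `Φ` a sizeable probability, and `Φ`
contradicts the mean residual life at age `a` under the nearly dominating law with parameter `u`,
then estimates are bad under the latter. -/
lemma le_paramLaw_bad (hlam : ∀ n, IsStoppingTime pathFiltration (lam n)) {u v : Param} {c : ℝ}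
    (hc1 : c ≤ 1) {j a T : ℕ} (hcT : 1 / 2 ≤ c ^ T) (hc0 : 0 ≤ c)
    (hdom : ∀ k, ENNReal.ofReal c * runPMF v k ≤ runPMF u k)
    {Φ : ℕ → (k : ℕ) → (Fin (k + 1) → Fin 2) → Prop}
    (hhits : zeroProb v / 4
      ≤ chainLaw (mean_runPMF_lt_top v) {m | m 0 = 0 ∧ collapse m ∈ hits lam j a T Φ})
    (htail : 0 < wtail a u)
    (hΦ : ∀ n t w, Φ n t w → 1 / 4 ≤ |h n t w - excess a u / wtail a u|) :
    zeroProb u / 8 ≤ paramLaw u (bad lam h (paramLaw u) j) := by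
  set S : Set (ℕ → ℕ) := {m | m 0 = 0 ∧ collapse m ∈ hits lam j a T Φ} with hSdef
  have hcol : ∀ {m m' : ℕ → ℕ}, (∀ i ≤ T, m i = m' i) → ∀ i ≤ T, collapse m i = collapse m' i :=
    fun hm i hi => by unfold collapse; rw [hm i hi]
  have hScongr : ∀ m m' : ℕ → ℕ, (∀ i ≤ T, m i = m' i) → m ∈ S → m' ∈ S := fun m m' hm hmS =>
    ⟨(hm 0 (Nat.zero_le _)).symm.trans hmS.1, hits_congr hlam (hcol hm) hmS.2⟩
  have hS : ∀ m m' : ℕ → ℕ, (∀ i ≤ T, m i = m' i) → (m ∈ S ↔ m' ∈ S) := fun m m' hm =>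
    ⟨hScongr m m' hm, hScongr m' m fun i hi => (hm i hi).symm⟩
  have hcomp := chainLaw_comparison (mean_runPMF_lt_top u) (mean_runPMF_lt_top v)
    (by simpa using hc1) hdom hS fun m hm => hm.1
  have hSle : zeroProb u / 8 ≤ chainLaw (mean_runPMF_lt_top u) S := by
    have h1 : ENNReal.ofReal (1 / 2) ≤ ENNReal.ofReal c ^ T := by
      rw [← ENNReal.ofReal_pow hc0]
      exact ENNReal.ofReal_le_ofReal hcT
    -- The 8 is the 4 of `hhits` times the loss `c ^ T ≥ 1 / 2`.
    have h2 : zeroProb v * (zeroProb u / 8) ≤ zeroProb v * chainLaw (mean_runPMF_lt_top u) S := by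
      refine le_trans ?_ hcomp
      calc zeroProb v * (zeroProb u / 8)
          = zeroProb u * (ENNReal.ofReal (1 / 2) * (zeroProb v / 4)) := by
            have h3 : ENNReal.ofReal (1 / 2) = 2⁻¹ := by
              rw [one_div, ENNReal.ofReal_inv_of_pos two_pos]; simp
            have h4 : (8 : ℝ≥0∞)⁻¹ = 2⁻¹ * 4⁻¹ := by
              rw [← ENNReal.mul_inv (by simp) (by simp)]; norm_num
            rw [h3, div_eq_mul_inv, div_eq_mul_inv, h4]
            ring
        _ ≤ _ := by
            change _ ≤ zeroProb u * _
            gcongr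
    exact (ENNReal.mul_le_mul_iff_right (zeroProb_pos v).ne' (zeroProb_ne_top v)).1 h2
  refine hSle.trans ?_
  have h1 : chainLaw (mean_runPMF_lt_top u) S ≤ paramLaw u (hits lam j a T Φ) :=
    (measure_mono fun m hm => hm.2).trans
      (Measure.le_map_apply measurable_collapse.aemeasurable _)
  refine h1.trans (measure_mono_ae ?_)
  filter_upwards [ae_cylinder_ne_zero (paramLaw u)] with x hx hxhit
  obtain ⟨n, hn, b, -, hb1, hb2, hb3, hb4⟩ := hxhit
  refine ⟨n, hn, b + a, hb1, ?_⟩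
  have h2 : theta (paramLaw u) (b + a) x = ENNReal.ofReal (excess a u / wtail a u) :=
    (theta_renewalLaw _ hb2 hb3 (hx (b + a))).trans (meanResidual_runPMF htail)
  have h3 : 0 ≤ excess a u / wtail a u := by
    refine div_nonneg (tsum_nonneg fun k => ?_) htail.le
    exact mul_nonneg (Nat.cast_nonneg _) (weight_nonneg u k)
  rw [h2, EReal.coe_ennreal_ofReal, max_eq_left h3, ← EReal.coe_sub, EReal.abs_def]
  exact ENNReal.ofReal_le_ofReal (hΦ _ _ _ hb4)

/-- By Bernoulli's inequality `1 - 1 / (2 (T + 1))` will do. -/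
lemma exists_contraction (T : ℕ) : ∃ c : ℝ, 0 ≤ c ∧ c < 1 ∧ 1 / 2 ≤ c ^ T := by
  have hT : (0 : ℝ) ≤ T := T.cast_nonneg
  have h2 : 1 / (2 * ((T : ℝ) + 1)) ≤ 1 / 2 := by
    gcongr; linarith
  refine ⟨1 - 1 / (2 * (T + 1)), by linarith, ?_, ?_⟩
  · have : 0 < 1 / (2 * ((T : ℝ) + 1)) := by positivity
    linarith
  · have h1 := one_add_mul_le_pow (a := -(1 / (2 * ((T : ℝ) + 1)))) (by linarith) T
    rw [← sub_eq_add_neg 1] at h1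
    refine le_trans ?_ h1
    have h3 : (T : ℝ) * (1 / (2 * (T + 1))) ≤ 1 / 2 := by
      rw [mul_one_div, div_le_div_iff₀ (by positivity) two_pos]
      linarith
    linarith

/-- The order of choices matters: `v` determines `a` and `T`, then `T` determines `c`, and only then
is the far mass placed, so far out that it is negligible up to time `T`. -/
lemma exists_eventually_bad (hlam : ∀ n, IsStoppingTime pathFiltration (lam n))
    (hmono : ∀ P : Measure Path, IsRenewalLaw P → ∀ᵐ x ∂P, StrictMono fun n => lam n x)
    (hlim : ∀ P : Measure Path, IsRenewalLaw P →
      ∀ᵐ x ∂P, Tendsto (fun n : ℕ => (lam n x : ℝ≥0∞) / (n : ℝ≥0∞)) atTop (𝓝 1))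
    (j : ℕ) (u₀ : Param) {r : ℝ} (hr : 0 < r) :
    ∃ v, dist v u₀ < r ∧
      ∀ᶠ u in 𝓝 v, zeroProb u / 8 ≤ paramLaw u (bad lam h (paramLaw u) j) := by
  obtain ⟨v, a, hdist, hsupp, htail, hex, htail'⟩ :=
    exists_near_finite u₀ (r := r / 2) (by positivity)
  have hweight : ∀ k, a < k → weight v k = 0 := fun k hk => by
    rw [weight, hsupp k hk, if_neg (by omega)]
    simp
  have hpa : runPMF v a ≠ 0 := by
    have h1 : tail (runPMF v) (a + 1) = 0 := by
      rw [tail, ENNReal.tsum_eq_zero]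
      intro k
      split_ifs with hk
      · rw [runPMF_apply, hweight k hk]; simp
      · rfl
    have h2 := tail_succ (runPMF v) a
    rw [h1, add_zero, tail_runPMF] at h2
    rw [← h2]
    exact mul_ne_zero (ENNReal.ofReal_pos.2 htail).ne' (by simp)
  obtain ⟨T, hT⟩ := exists_hits (mean_runPMF_lt_top v)
    (hmono _ (isRenewalLaw_renewalLaw _)) (hlim _ (isRenewalLaw_renewalLaw _))
    (fun k hk => by rw [runPMF_apply, hweight k hk]; simp) hpa j
  obtain ⟨c, hc0, hc1, hcT⟩ := exists_contraction T
  have hct : Continuous fun u => excess a u := continuous_wsum (moderate_sub a)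
  have hcw : Continuous fun u => wtail a u := continuous_wsum (moderate_tail a)
  -- The threshold 1/2 is at distance 1/4 from both 1/4 and 3/4, which bound the mean residual lives
  -- near `v` and near the raised parameter.
  have hsplit : zeroProb v / 4 ≤ chainLaw (mean_runPMF_lt_top v)
        {m | m 0 = 0 ∧ collapse m ∈ hits lam j a T fun n t w => 1 / 2 ≤ h n t w}
      ∨ zeroProb v / 4 ≤ chainLaw (mean_runPMF_lt_top v)
        {m | m 0 = 0 ∧ collapse m ∈ hits lam j a T fun n t w => h n t w < 1 / 2} := by
    by_contra! hlt
    have h1 : chainLaw (mean_runPMF_lt_top v)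
        {m | m 0 = 0 ∧ collapse m ∈ hits lam j a T fun _ _ _ => True} < zeroProb v / 2 := by
      have h2 : zeroProb v / 2 = zeroProb v / 4 + zeroProb v / 4 := by
        have h3 : (4 : ℝ≥0∞)⁻¹ = 2⁻¹ * 2⁻¹ := by
          rw [← ENNReal.mul_inv (by simp) (by simp)]; norm_num
        rw [div_eq_mul_inv, div_eq_mul_inv, h3, ← mul_add, ← mul_add, ENNReal.inv_two_add_inv_two,
          mul_one]
      rw [h2]
      refine lt_of_le_of_lt ?_ (ENNReal.add_lt_add hlt.1 hlt.2)
      refine (measure_mono ?_).trans (measure_union_le _ _)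
      rintro m ⟨h0, n, hn, b, hb, h1, h2, h3, -⟩
      rcases le_or_gt (1 / 2) (h n (b + a) (observed (b + a) (collapse m))) with h4 | h4
      · exact .inl ⟨h0, n, hn, b, hb, h1, h2, h3, h4⟩
      · exact .inr ⟨h0, n, hn, b, hb, h1, h2, h3, h4⟩
    exact absurd hT (not_le.2 h1)
  rcases hsplit with hbig | hsmall
  · refine ⟨v, by linarith, ?_⟩
    have h1 : ∀ᶠ u in 𝓝 v, excess a u / wtail a u < 1 / 4 := by
      refine (hct.continuousAt.div hcw.continuousAt htail.ne').eventually_lt_const ?_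
      simp [hex]
    have hcv : c * total v < total v := by nlinarith [total_pos v]
    filter_upwards [h1, hcw.continuousAt.eventually_const_lt htail,
      eventually_dominates hweight (fun k => le_rfl) hc0 hcv] with u hu1 hu2 hu3
    refine le_paramLaw_bad hlam hc1.le hcT hc0 hu3 hbig hu2 fun n t w hw => ?_
    exact le_trans (by linarith) (le_abs_self _)
  -- The domination is still by the law of `v`, under which the low estimates were found; only the
  -- true mean has moved.
  · obtain ⟨v', hv1, hv2, hv3, hv4⟩ := exists_raised hsupp hex (half_pos hr) htail' htail hc1
    have htail2 : 0 < wtail a v' := by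
      refine htail.trans_le ((summable_wsum (moderate_tail a) v).tsum_le_tsum (fun k => ?_)
        (summable_wsum (moderate_tail a) v'))
      exact mul_le_mul_of_nonneg_left (hv2 k) (moderate_tail a k).1
    refine ⟨v', (dist_triangle v' v u₀).trans_lt (by linarith), ?_⟩
    have h1 : ∀ᶠ u in 𝓝 v', 3 / 4 < excess a u / wtail a u :=
      (hct.continuousAt.div hcw.continuousAt htail2.ne').eventually_const_lt hv4
    filter_upwards [h1, hcw.continuousAt.eventually_const_lt htail2,
      eventually_dominates hweight hv2 hc0 hv3] with u hu1 hu2 hu3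
    refine le_paramLaw_bad hlam hc1.le hcT hc0 hu3 hsmall hu2 fun n t w hw => ?_
    rw [abs_sub_comm]
    exact le_trans (by linarith) (le_abs_self _)

/-- Baire's theorem in the complete space `Param`. -/
lemma exists_forall_bad (hlam : ∀ n, IsStoppingTime pathFiltration (lam n))
    (hmono : ∀ P : Measure Path, IsRenewalLaw P → ∀ᵐ x ∂P, StrictMono fun n => lam n x)
    (hlim : ∀ P : Measure Path, IsRenewalLaw P →
      ∀ᵐ x ∂P, Tendsto (fun n : ℕ => (lam n x : ℝ≥0∞) / (n : ℝ≥0∞)) atTop (𝓝 1)) :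
    ∃ u, ∀ j, zeroProb u / 8 ≤ paramLaw u (bad lam h (paramLaw u) j) := by
  have hdense : Dense (⋂ j : ℕ,
      interior {u | zeroProb u / 8 ≤ paramLaw u (bad lam h (paramLaw u) j)}) := by
    refine dense_iInter_of_isOpen (fun j => isOpen_interior) fun j => ?_
    rw [Metric.dense_iff]
    intro u₀ r hr
    obtain ⟨v, hv, hev⟩ := exists_eventually_bad (h := h) hlam hmono hlim j u₀ hr
    exact ⟨v, hv, mem_interior_iff_mem_nhds.2 hev⟩
  obtain ⟨u, hu⟩ := hdense.nonempty
  refine ⟨u, fun j => ?_⟩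
  have huj := interior_subset (Set.mem_iInter.1 hu j)
  exact huj

end

end BinaryRenewal

end

theorem theorem4
    (lam : ℕ → BinaryRenewal.Path → ℕ∞)
    (h : ℕ → (k : ℕ) → (Fin (k + 1) → Fin 2) → ℝ)
    (hlam : ∀ n, IsStoppingTime BinaryRenewal.pathFiltration (lam n))
    (hmono : ∀ P : Measure BinaryRenewal.Path, BinaryRenewal.IsRenewalLaw P →
      ∀ᵐ x ∂P, StrictMono fun n => lam n x)
    (hlim : ∀ P : Measure BinaryRenewal.Path, BinaryRenewal.IsRenewalLaw P →
      ∀ᵐ x ∂P, Tendsto (fun n : ℕ => (lam n x : ℝ≥0∞) / (n : ℝ≥0∞)) atTop (𝓝 1)) :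
    ∃ P : Measure BinaryRenewal.Path, BinaryRenewal.IsRenewalLaw P ∧
      0 < P {x | 0 < limsup (fun n : ℕ =>
        (((h n (lam n x).toNat (BinaryRenewal.observed (lam n x).toNat x) : ℝ) : EReal)
          - (BinaryRenewal.theta P (lam n x).toNat x : EReal)).abs) atTop} := by
  obtain ⟨u, hu⟩ := BinaryRenewal.exists_forall_bad (h := h) hlam hmono hlim
  set P := BinaryRenewal.paramLaw u with hP
  refine ⟨P, BinaryRenewal.isRenewalLaw_renewalLaw _, ?_⟩
  have hanti : Antitone (BinaryRenewal.bad lam h P) := fun j j' hj x ⟨n, hn, hx⟩ =>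
    ⟨n, hj.trans hn, hx⟩
  -- Continuity from above along the decreasing sets `bad` keeps the bound, as it is uniform in `j`.
  have h1 : BinaryRenewal.zeroProb u / 8 ≤ P (⋂ j, BinaryRenewal.bad lam h P j) := by
    rw [hanti.measure_iInter
      (fun j => (BinaryRenewal.measurableSet_bad hlam P j).nullMeasurableSet)
      ⟨0, measure_ne_top _ _⟩]
    exact le_iInf hu
  have h2 : 0 < BinaryRenewal.zeroProb u / 8 :=
    ENNReal.div_pos (BinaryRenewal.zeroProb_pos u).ne' (by simp)
  refine (h2.trans_le h1).trans_le (measure_mono fun x hx => ?_)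
  have h3 : ENNReal.ofReal (1 / 4) ≤ limsup (fun n : ℕ =>
      (((h n (lam n x).toNat (BinaryRenewal.observed (lam n x).toNat x) : ℝ) : EReal)
        - (BinaryRenewal.theta P (lam n x).toNat x : EReal)).abs) atTop := by
    refine le_limsup_of_frequently_le (frequently_atTop.2 fun j => ?_)
    obtain ⟨n, hn, t, ht, hbad⟩ := Set.mem_iInter.1 hx j
    refine ⟨n, hn, ?_⟩
    -- On `bad` the stopping time is finite, so the default value of `toNat` plays no role.
    rw [ht, ENat.toNat_natCast]
    exact hbad
  exact (ENNReal.ofReal_pos.2 (by norm_num)).trans_le h3
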